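/- A conic Minkowski metric on $\mathbb R^3$ is a smooth, positively $1$-homogeneous function $F\ge 0$ on a nonempty open cone $A\subset\mathbb R^3\setminus\{0\}$ (not required to be connected) such that $g_y=\tfrac12 D^2(F^2)(y)$ is positive definite for all $y\in A$. Its Legendre transformation is $\mathcal L(y)=F(y)\,dF(y)$. When $\mathcal L$ is injective on $A$, its dual metric is $F^*=F\circ\mathcal L^{-1}$ on $A^*=\mathcal L(A)\subset(\mathbb R^3)^*$. A conic hypersurface is an immersed hypersurface with a smooth unit normal field, i.e. a field $\mathbf n\in A$ with $F(\mathbf n)=1$ and $\mathcal L(\mathbf n)$ vanishing on the tangent planes. The principal curvatures with respect to $\mathbf n$ are the eigenvalues of $X\mapsto -[D_X\mathbf n]^{T}$, where $D$ is the ordinary derivative and $T$ the $g_{\mathbf n}$-orthogonal projection to the tangent plane; their sum is the mean curvature, and the hypersurface is minimal if the mean curvature vanishes for every local unit normal field. For a function $f$ put $\nabla f=\mathcal L^{-1}(df)$ where $df\in A^*$, $\nabla f=0$ where $df=0$, and $\hat\Delta f=\operatorname{tr}(D\nabla f)$. A non-constant $C^1$ function $f$ on an open set $U$ is isoparametric if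 $df\in A^*$ wherever $df\ne0$ and, on $M_f=\{x\in U: df(x)\neq 0\}$, $f$ is smooth and $F(\nabla f)=p(f)$, $\hat\Delta f=q(f)$ for a smooth function $p$ and a continuous function $q$ on $f(M_f)$. A set $N$ is a local isoparametric hypersurface if each of its points has an open neighbourhood $U$ with an isoparametric function $f$ on $U$ such that $N\cap U$ is a level set of $f$ on which $df\neq0$. **Theorem.** Let $a,b>0$. Let $\alpha$ be the Euclidean norm on $\mathbb R^3$, $\alpha^*$ its dual norm, $\beta^*=(0,0,b)$, regarded as the function $\xi\mapsto b\,\xi_3$ on covectors, and $\beta(y)=b\,y^3$. Let $$F^*=\alpha^*\phi\Big(\frac{\beta^*}{\alpha^*}\Big),\qquad \phi(s)=\frac{\sqrt{b^2-(1+a^2)s^2}}{b}-\frac{as}{b}\arctan\frac{\sqrt{b^2-(1+a^2)s^2}}{as},\qquad 0<|s|<\frac{b}{\sqrt{1+a^2}},$$ on the cone $A^*$ of the covectors $\xi\ne0$ for which $s=\beta^*(\xi)/\alpha^*(\xi)$ lies in this range. 1. There is a conic Minkowski metric $F$ on $\mathbb R^3$, with $\mathcal L$ injective on its domain, whose dual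 metric is $F^*$ with domain $A^*$, and which is an $(\alpha,\beta)$-metric: for some $b_0\ge\|\beta\|_\alpha=b$, some closed $E\subset[-b_0,b_0]$ and some smooth $\psi:[-b_0,b_0]\setminus E\to(0,\infty)$ one has $F=\alpha\,\psi(\beta/\alpha)$, with domain $\{y\neq0:\beta(y)/\alpha(y)\in[-b_0,b_0]\setminus E\}$, and $\psi-s\psi'>0$, $\psi-s\psi'+(c^2-s^2)\psi''>0$ for all $c\in[0,b_0]$ and $s\in[-c,c]\setminus E$. 2. For every conic Minkowski metric $F$ on $\mathbb R^3$ whose dual metric is $F^*$ with domain $A^*$, the helicoid $N$ given by $\mathbf r(u,v)=(u\cos v,u\sin v,av)$, $0<u<1$, $v\in\mathbb R$, is a conic hypersurface, is minimal, and is a local isoparametric hypersurface; with respect to every local unit normal field its principal curvatures at every point are exactly $1$ and $-1$. 3. For $F$ as in 2, no nonempty relatively open subset of $N$ is contained in a translate of a conic Minkowski cylinder. Here, for a subspace $W\subset(\mathbb R^3)^*$ and a real number $r$, the conic Minkowski cylinder $\Sigma_r$ over $W$ consists of the $x\in\mathbb R^3$ for which there is $\xi\in W\cap A^*$ with $F^*(\xi)=r$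 and $\eta(x)=F^*(\xi)\,dF^*_\xi(\eta)$ for all $\eta\in W$. (Equivalently, where the dual metric $\tilde F$ of $F^*|_{W\cap A^*}$ is defined, $\tilde F(\bar x)=r$ and $d\tilde F(\bar x)\in A^*$, with $\bar x=x|_W$.) Thus a hypersurface with two distinct constant principal curvatures need not be a cylinder. -/

import Mathlib

open Set
open scoped ContDiff

noncomputable section

/-- A conic Minkowski metric on a real vector space `E`: an open cone `dom` of nonzero vectors with
a smooth, positively homogeneous function `F ≥ 0` on it whose fundamental tensor
`g_y = (1/2) D²(F²)(y)` is positive definite. The values of `F` off `dom` are irrelevant. -/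
structure ConicMinkowskiMetric (E : Type*) [NormedAddCommGroup E] [NormedSpace ℝ E] where
  /-- the conic domain -/
  dom : Set E
  /-- the metric -/
  F : E → ℝ
  isOpen_dom : IsOpen dom
  nonempty_dom : dom.Nonempty
  zero_notMem : (0 : E) ∉ dom
  smul_mem : ∀ t : ℝ, 0 < t → ∀ y ∈ dom, t • y ∈ dom
  nonneg : ∀ y ∈ dom, 0 ≤ F y
  smooth : ContDiffOn ℝ ∞ F dom
  homogeneous : ∀ t : ℝ, 0 < t → ∀ y ∈ dom, F (t • y) = t * F y
  posDef : ∀ y ∈ dom, ∀ v : E, v ≠ 0 →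
    0 < (1 / 2 : ℝ) * fderiv ℝ (fderiv ℝ (fun z => F z ^ 2)) y v v

namespace ConicMinkowskiMetric

section Minkowski

variable {E : Type*} [NormedAddCommGroup E] [NormedSpace ℝ E] (M : ConicMinkowskiMetric E)

/-- The fundamental tensor `g_y(v, w) = (1/2) D²(F²)(y)(v, w)`. -/
def fundamentalTensor (y v w : E) : ℝ :=
  (1 / 2 : ℝ) * fderiv ℝ (fderiv ℝ (fun z => M.F z ^ 2)) y v w

/-- The Legendre transformation `y ↦ F(y) dF(y)`. -/
def legendre (y : E) : StrongDual ℝ E := M.F y • fderiv ℝ M.F y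

/-- The domain `A* = L(A)` of the dual metric. -/
def dualDom : Set (StrongDual ℝ E) := M.legendre '' M.dom

/-- The inverse of the Legendre transformation of `A` onto `A*` (used when `L` is injective on `A`,
and meaningful on `A*`). -/
def legendreInv : StrongDual ℝ E → E := Function.invFunOn M.legendre M.dom

/-- The dual metric `F* = F ∘ L⁻¹`, meaningful on `A*`. -/
def dualMetric (ξ : StrongDual ℝ E) : ℝ := M.F (M.legendreInv ξ)

/-- The domain of `F` is an applicable cone (`L` is injective on it), and the dual metric of `F` is
the function `Fs` with domain `As`. -/
structure HasDual (As : Set (StrongDual ℝ E)) (Fs : StrongDual ℝ E → ℝ) : Prop where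
  applicable : InjOn M.legendre M.dom
  dualDom_eq : M.dualDom = As
  dualMetric_eq : EqOn M.dualMetric Fs As

open Classical in
/-- The conic gradient: `∇f(x) = L⁻¹(df(x))` where `df(x) ≠ 0` (and `df(x) ∈ A*`), and `0` where
`df(x) = 0`. -/
def gradient (f : E → ℝ) (x : E) : E :=
  if fderiv ℝ f x = 0 then 0 else M.legendreInv (fderiv ℝ f x)

/-- The nonlinear Finsler Laplacian `tr(∇²f)`, with `∇²f = D^{∇f}(∇f)` the (1,1)-tensor
`v ↦ D_v^{∇f}(∇f)`. As `F` does not depend on the base point, the Chern connection coefficients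
vanish and `D` is the ordinary derivative. -/
def laplacian (f : E → ℝ) (x : E) : ℝ :=
  LinearMap.trace ℝ E (fderiv ℝ (M.gradient f) x : E →ₗ[ℝ] E)

/-- The set `M_f` of the points of `U` at which `df ≠ 0` and `df ∈ A*`. -/
def regularSet (f : E → ℝ) (U : Set E) : Set E :=
  {x ∈ U | fderiv ℝ f x ≠ 0 ∧ fderiv ℝ f x ∈ M.dualDom}

/-- `f` is an isoparametric function on the open set `U` (with the metric `F`). -/
structure IsIsoparametricOn (f : E → ℝ) (U : Set E) : Prop where
  isOpen : IsOpen U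
  nonconstant : ∃ x ∈ U, ∃ y ∈ U, f x ≠ f y
  contDiffOn_one : ContDiffOn ℝ 1 f U
  fderiv_mem : ∀ x ∈ U, fderiv ℝ f x ≠ 0 → fderiv ℝ f x ∈ M.dualDom
  smooth : ContDiffOn ℝ ∞ f (M.regularSet f U)
  exists_eq : ∃ p q : ℝ → ℝ,
    ContDiffOn ℝ ∞ p (f '' M.regularSet f U) ∧ ContinuousOn q (f '' M.regularSet f U) ∧
      ∀ x ∈ M.regularSet f U, M.F (M.gradient f x) = p (f x) ∧ M.laplacian f x = q (f x)

/-- `N` is a local isoparametric hypersurface: near each of its points it is a regular level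
hypersurface of an isoparametric function. -/
def IsLocalIsoparametric (N : Set E) : Prop :=
  ∀ x ∈ N, ∃ (U : Set E) (f : E → ℝ) (t : ℝ), x ∈ U ∧ M.IsIsoparametricOn f U ∧
    N ∩ U = {y ∈ U | f y = t} ∧ ∀ y ∈ N ∩ U, fderiv ℝ f y ≠ 0

/-- The conic Minkowski cylinder `Σ_r` over a subspace `W` of the dual space:
`{x | F̃(x̄) = r, dF̃(x̄) ∈ A*}`, where `x̄` is `x` as a functional on `W` and `F̃` is the dual metric
of the restriction of `F*` to `W ∩ A*`. In terms of the Legendre transformation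
`ξ ↦ F*(ξ) dF*(ξ)|_W` of that restriction, whose inverse takes `x̄` to `ξ = F̃(x̄) dF̃(x̄)`,
this says that `x̄` is the image of some `ξ ∈ W ∩ A*` with `F*(ξ) = r`. -/
def cylinder (W : Submodule ℝ (StrongDual ℝ E)) (r : ℝ) : Set E :=
  {x | ∃ ξ ∈ W, ξ ∈ M.dualDom ∧ M.dualMetric ξ = r ∧
    ∀ η ∈ W, η x = M.dualMetric ξ * fderiv ℝ M.dualMetric ξ η}

section Immersed

variable {P : Type*} [NormedAddCommGroup P] [NormedSpace ℝ P]

/-- `n` is a smooth unit normal vector field along `Φ` on `W`: `n ∈ A`, `F(n) = 1`, i.e.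
`F*(L(n)) = 1`, and the covector `L(n)` vanishes on the tangent spaces of `Φ`. -/
structure IsUnitNormalOn (Φ n : P → E) (W : Set P) : Prop where
  smooth : ContDiffOn ℝ ∞ n W
  mem_dom : ∀ p ∈ W, n p ∈ M.dom
  unit : ∀ p ∈ W, M.F (n p) = 1
  conormal : ∀ p ∈ W, ∀ X : P, M.legendre (n p) (fderiv ℝ Φ p X) = 0

/-- `Φ : Ω → E` is a conic hypersurface: a smooth immersion of codimension one with a unit normal
vector field. -/
structure IsConicHypersurface (Φ : P → E) (Ω : Set P) : Prop where
  isOpen : IsOpen Ω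
  codim : Module.finrank ℝ E = Module.finrank ℝ P + 1
  smooth : ContDiffOn ℝ ∞ Φ Ω
  immersion : ∀ p ∈ Ω, Function.Injective (fderiv ℝ Φ p)
  exists_normal : ∃ n : P → E, M.IsUnitNormalOn Φ n Ω

/-- `S` is the shape operator `X ↦ -[D_X n]^T` of `Φ` at `p`, where `T` is the `g_n`-orthogonal
projection to the tangent space, which is identified with `P` by the differential of `Φ`. -/
def IsShapeOperator (Φ n : P → E) (p : P) (S : P →ₗ[ℝ] P) : Prop :=
  ∀ X Y : P,
    M.fundamentalTensor (n p) (fderiv ℝ Φ p (S X) + fderiv ℝ n p X) (fderiv ℝ Φ p Y) = 0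

/-- `k` is a principal curvature at `p` with respect to `n`: an eigenvalue of the shape operator. -/
def IsPrincipalCurvature (Φ n : P → E) (p : P) (k : ℝ) : Prop :=
  ∃ S : P →ₗ[ℝ] P, M.IsShapeOperator Φ n p S ∧ Module.End.HasEigenvalue S k

/-- `H` is the mean curvature (the trace of the shape operator) at `p` with respect to `n`. -/
def IsMeanCurvature (Φ n : P → E) (p : P) (H : ℝ) : Prop :=
  ∃ S : P →ₗ[ℝ] P, M.IsShapeOperator Φ n p S ∧ LinearMap.trace ℝ P S = H

/-- The mean curvature vanishes with respect to every local unit normal vector field. -/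
def IsMinimal (Φ : P → E) (Ω : Set P) : Prop :=
  ∀ (W : Set P) (n : P → E), IsOpen W → W ⊆ Ω → M.IsUnitNormalOn Φ n W →
    ∀ p ∈ W, M.IsMeanCurvature Φ n p 0

end Immersed

end Minkowski

/-- `F` is a conic Minkowski `(α, β)`-metric `α φ(β/α)`, where `α` is the norm of the inner product
and `β` is a linear form. Derivatives of `φ` are taken within its domain `[-b₀, b₀] \ C`. -/
def IsAlphaBeta {E : Type*} [NormedAddCommGroup E] [InnerProductSpace ℝ E]
    (M : ConicMinkowskiMetric E) (β : StrongDual ℝ E) : Prop :=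
  ∃ (b₀ : ℝ) (C : Set ℝ) (φ : ℝ → ℝ), ‖β‖ ≤ b₀ ∧ IsClosed C ∧ C ⊆ Icc (-b₀) b₀ ∧
    ContDiffOn ℝ ∞ φ (Icc (-b₀) b₀ \ C) ∧
    (∀ s ∈ Icc (-b₀) b₀ \ C, 0 < φ s) ∧
    (∀ c ∈ Icc 0 b₀, ∀ s ∈ Icc (-c) c \ C,
      0 < φ s - s * derivWithin φ (Icc (-b₀) b₀ \ C) s ∧
      0 < φ s - s * derivWithin φ (Icc (-b₀) b₀ \ C) s
        + (c ^ 2 - s ^ 2) * iteratedDerivWithin 2 φ (Icc (-b₀) b₀ \ C) s) ∧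
    M.dom = {y | y ≠ 0 ∧ β y / ‖y‖ ∈ Icc (-b₀) b₀ \ C} ∧
    ∀ y ∈ M.dom, M.F y = ‖y‖ * φ (β y / ‖y‖)

end ConicMinkowskiMetric

/-- The function `φ` of the dual metric, for `0 < |s| < b / √(1 + a²)`. -/
def helicoidPhi (a b s : ℝ) : ℝ :=
  √(b ^ 2 - (1 + a ^ 2) * s ^ 2) / b
    - a * s / b * Real.arctan (√(b ^ 2 - (1 + a ^ 2) * s ^ 2) / (a * s))

/-- The vector `β* = (0, 0, b)`; as a function of covectors it is `ξ ↦ ξ(β*) = b ξ₃`. -/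
def betaStar (b : ℝ) : EuclideanSpace ℝ (Fin 3) := !₂[0, 0, b]

/-- The conic domain `0 < |s| < b / √(1 + a²)`, `s = β*/α*`, of the dual metric; `α*` is the dual
norm of the Euclidean norm. The covector `0` is excluded, since `0 / 0 = 0` here. -/
def helicoidDualDom (a b : ℝ) : Set (StrongDual ℝ (EuclideanSpace ℝ (Fin 3))) :=
  {ξ | 0 < |ξ (betaStar b) / ‖ξ‖| ∧ |ξ (betaStar b) / ‖ξ‖| < b / √(1 + a ^ 2)}

/-- The dual metric `F* = α* φ(β*/α*)`. -/
def helicoidDualMetric (a b : ℝ) (ξ : StrongDual ℝ (EuclideanSpace ℝ (Fin 3))) : ℝ :=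
  ‖ξ‖ * helicoidPhi a b (ξ (betaStar b) / ‖ξ‖)

/-- The helicoid `(u, v) ↦ (u cos v, u sin v, a v)`. -/
def helicoid (a : ℝ) (p : ℝ × ℝ) : EuclideanSpace ℝ (Fin 3) :=
  !₂[p.1 * Real.cos p.2, p.1 * Real.sin p.2, a * p.2]

/-- The parameter domain `0 < u < 1`, `v ∈ ℝ`. -/
def helicoidParams : Set (ℝ × ℝ) := Ioo 0 1 ×ˢ univ

end

/-!
In the coordinates of a covector put `ρ = |(ξ₀, ξ₁)|`. The constant `b` cancels, and with
`cos θ = a |ξ₂| / ρ` the dual metric is `F* = ρ (sin θ - θ cos θ)`, whose differential is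
`sin θ dρ ∓ a θ dξ₂`. So the indicatrix of `F` consists of the two surfaces of revolution
`(sin θ cos φ, sin θ sin φ, ± a θ)` with `0 < θ < π / 2`. This describes `F` without reference to
`F*`: if `r` is the distance of `y` to the vertical axis and `H = |y₂| / a`, then
`(r, H) = F (sin θ, θ)`, and `θ` is obtained by inverting `θ / sin θ` (`angle`, `profile`).

* With `g = sin θ - θ cos θ` one finds `dF = (dr - cos θ dH) / g`, and along a curve
  `F'' = (r'' - cos θ H'') / g + (F sin θ / g) θ' ^ 2` (`hasDerivAt_deriv_profile`). Along lines this
  gives positive definiteness (`fundamental_pos`); along the meridian of Euclidean unit vectors it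
  gives the two inequalities on `ψ` (`alphaBeta_first`, `alphaBeta_second`). The Legendre
  transformation is explicit, and so is its inverse (`hasDual`).
* Any metric with the given dual metric agrees with this one, because a point `y` with Legendre
  transform `ξ` is `F*(ξ) dF*(ξ)` (`ConicMinkowskiMetric.HasDual.apply_eq`).
* The conormal `(a sin v, -a cos v, u)` of the helicoid belongs to `θ = arccos u`, so the unit
  normals are `± n` with `n = (sin θ sin v, -sin θ cos v, -a θ)`. In the parameters `θ`, `v` one has
  `∂n/∂θ = -∂r/∂v` and `∂n/∂v = -∂r/∂θ`; the shape operator interchanges the two directions, and its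
  eigenvalues are `1` and `-1` (`hasEigenvalue_shape_iff`).
* The map `(p, t) ↦ r(p) + t n(p)` is a local diffeomorphism for `|t| < 1`. Its coordinate `t` has
  gradient `n` and Laplacian `-2 t / (1 - t ^ 2)`, hence is isoparametric (`isLocalIsoparametric`).
* If a piece of the helicoid lay in a cylinder over `W`, the rulings would map to segments in the
  indicatrix of the metric on `W`. By strict convexity these segments are points
  (`apply_eq_zero_of_segment`), so `W` annihilates all rulings and with them the horizontal plane;
  but no covector in `A*` does (`not_subset_cylinder`).
-/

namespace HelicoidMetric

open Real Filter Topology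

/-! ### The inverse of `θ / sin θ` and the meridian profile -/

/-- The function `sin θ - θ cos θ`: it is the dual metric on a covector with horizontal part of
length `1` and vertical part `± cos θ / a`. -/
noncomputable def gap (θ : ℝ) : ℝ := sin θ - θ * cos θ

/-- The angle `θ ∈ (0, π / 2)` with `θ / sin θ = x`, meaningful for `1 < x < π / 2`. -/
noncomputable def angle (x : ℝ) : ℝ := Function.invFunOn (fun θ => θ / sin θ) (Ioo 0 (π / 2)) x

/-- The metric in the meridian half-plane: `F = profile r H` is the factor for which
`(r, H) = F • (sin θ, θ)` for some `θ ∈ (0, π / 2)`. Here `r` is the distance to the axis and `H`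
is the height divided by `a`. -/
noncomputable def profile (r H : ℝ) : ℝ := r / sin (angle (H / r))

section Angle

variable {θ x : ℝ}

theorem sin_pos_of_mem (hθ : θ ∈ Ioo 0 (π / 2)) : 0 < sin θ :=
  sin_pos_of_pos_of_lt_pi hθ.1 (by linarith [hθ.2, pi_pos])

theorem cos_pos_of_mem (hθ : θ ∈ Ioo 0 (π / 2)) : 0 < cos θ :=
  cos_pos_of_mem_Ioo ⟨by linarith [hθ.1, pi_pos], hθ.2⟩

theorem gap_pos (hθ : θ ∈ Ioo 0 (π / 2)) : 0 < gap θ := by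
  have h := lt_tan hθ.1 hθ.2
  rw [tan_eq_sin_div_cos, lt_div_iff₀ (cos_pos_of_mem hθ)] at h
  unfold gap; linarith

theorem hasDerivAt_gap (θ : ℝ) : HasDerivAt gap (θ * sin θ) θ := by
  have := (hasDerivAt_sin θ).sub ((hasDerivAt_id θ).mul (hasDerivAt_cos θ))
  refine this.congr_deriv ?_
  simp

theorem hasDerivAt_div_sin (hθ : θ ∈ Ioo 0 (π / 2)) :
    HasDerivAt (fun θ => θ / sin θ) (gap θ / sin θ ^ 2) θ := by
  have := (hasDerivAt_id θ).div (hasDerivAt_sin θ) (sin_pos_of_mem hθ).ne'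
  refine this.congr_deriv ?_
  simp [gap]

theorem div_sin_injOn : InjOn (fun θ => θ / sin θ) (Ioo 0 (π / 2)) := by
  refine (strictMonoOn_of_deriv_pos (convex_Ioo _ _)
    (fun θ hθ => (hasDerivAt_div_sin hθ).continuousAt.continuousWithinAt) fun θ hθ => ?_).injOn
  rw [interior_Ioo] at hθ
  rw [(hasDerivAt_div_sin hθ).deriv]
  exact div_pos (gap_pos hθ) (pow_pos (sin_pos_of_mem hθ) 2)

theorem div_sin_mem (hθ : θ ∈ Ioo 0 (π / 2)) : θ / sin θ ∈ Ioo 1 (π / 2) := by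
  have hs := sin_pos_of_mem hθ
  constructor
  · rw [lt_div_iff₀ hs, one_mul]; exact sin_lt hθ.1
  · have := mul_lt_sin hθ.1 hθ.2
    rw [div_mul_eq_mul_div, div_lt_iff₀ pi_pos] at this
    rw [div_lt_iff₀ hs]; linarith

theorem exists_div_sin_eq (hx : x ∈ Ioo 1 (π / 2)) :
    ∃ θ ∈ Ioo 0 (π / 2), θ / sin θ = x := by
  have h1 := hx.1
  -- For small `ε` the cubic lower bound of the sine gives `ε / sin ε < x`.
  set ε : ℝ := min 1 (x - 1)
  have hε0 : 0 < ε := lt_min one_pos (by linarith)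
  have hε1 : ε ≤ 1 := min_le_left _ _
  have hε2 : ε ≤ x - 1 := min_le_right _ _
  have hp : 1 < π / 2 := by linarith [pi_gt_three]
  have hs := sin_gt_sub_cube hε0
  have hpos : 0 ≤ x * sin ε - ε := by
    have : x * (ε - ε ^ 3 / 6) ≤ x * sin ε := by gcongr
    have h3 : ε ≤ (1 + ε) * (ε - ε ^ 3 / 6) := by
      have : 0 ≤ ε ^ 2 * (1 - ε / 6 - ε ^ 2 / 6) :=
        mul_nonneg (sq_nonneg _) (by nlinarith)
      linarith
    have h4 : 0 ≤ ε - ε ^ 3 / 6 := by nlinarith [mul_pos hε0 hε0]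
    nlinarith
  have hneg : x * sin (π / 2) - π / 2 < 0 := by rw [sin_pi_div_two]; linarith [hx.2]
  have hc : ContinuousOn (fun θ => x * sin θ - θ) (Icc ε (π / 2)) := by fun_prop
  obtain ⟨θ, hθ, h0⟩ := intermediate_value_Icc' (by linarith) hc ⟨hneg.le, hpos⟩
  have hθ2 : θ ≠ π / 2 := by rintro rfl; simp only at h0; linarith
  have hmem : θ ∈ Ioo 0 (π / 2) := ⟨by linarith [hθ.1], lt_of_le_of_ne hθ.2 hθ2⟩
  refine ⟨θ, hmem, ?_⟩
  rw [div_eq_iff (sin_pos_of_mem hmem).ne']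
  simp only at h0; linarith

theorem angle_mem (hx : x ∈ Ioo 1 (π / 2)) : angle x ∈ Ioo 0 (π / 2) :=
  Function.invFunOn_mem (exists_div_sin_eq hx)

theorem angle_div_sin (hx : x ∈ Ioo 1 (π / 2)) : angle x / sin (angle x) = x :=
  Function.invFunOn_eq (f := fun θ => θ / sin θ) (exists_div_sin_eq hx)

theorem angle_of_div_sin (hθ : θ ∈ Ioo 0 (π / 2)) : angle (θ / sin θ) = θ :=
  div_sin_injOn (angle_mem (div_sin_mem hθ)) hθ (angle_div_sin (div_sin_mem hθ))

theorem contDiffAt_angle (hx : x ∈ Ioo 1 (π / 2)) : ContDiffAt ℝ ∞ angle x := by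
  obtain ⟨θ, hθ, rfl⟩ := exists_div_sin_eq hx
  have hs := (sin_pos_of_mem hθ).ne'
  have hd := hasDerivAt_div_sin hθ
  have hne : gap θ / sin θ ^ 2 ≠ 0 := div_ne_zero (gap_pos hθ).ne' (pow_ne_zero 2 hs)
  have hk : ContDiffAt ℝ ∞ (fun θ => θ / sin θ) θ :=
    contDiffAt_id.div contDiff_sin.contDiffAt hs
  have hd' : HasFDerivAt (fun θ => θ / sin θ)
      ((ContinuousLinearEquiv.unitsEquivAut ℝ (Units.mk0 _ hne) : ℝ ≃L[ℝ] ℝ) : ℝ →L[ℝ] ℝ) θ := by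
    refine hd.hasFDerivAt.congr_fderiv ?_
    ext; simp
  have hn : (∞ : WithTop ℕ∞) ≠ 0 := by simp
  refine (hk.to_localInverse hd' hn).congr_of_eventuallyEq ?_
  have hst := hk.hasStrictFDerivAt' hd' hn
  have hmem : ∀ᶠ y in 𝓝 (θ / sin θ), hk.localInverse hd' hn y ∈ Ioo 0 (π / 2) :=
    hst.localInverse_tendsto (isOpen_Ioo.mem_nhds hθ)
  filter_upwards [hmem, hst.eventually_right_inverse] with y hy hy'
  conv_lhs => rw [← hy']
  exact angle_of_div_sin hy

theorem hasDerivAt_angle (hx : x ∈ Ioo 1 (π / 2)) :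
    HasDerivAt angle (sin (angle x) ^ 2 / gap (angle x)) x := by
  have hθ := angle_mem hx
  have hne : gap (angle x) / sin (angle x) ^ 2 ≠ 0 :=
    div_ne_zero (gap_pos hθ).ne' (pow_ne_zero 2 (sin_pos_of_mem hθ).ne')
  refine ((hasDerivAt_div_sin hθ).of_local_left_inverse (contDiffAt_angle hx).continuousAt hne
    ?_).congr_deriv (by rw [inv_div])
  filter_upwards [isOpen_Ioo.mem_nhds hx] with y hy using angle_div_sin hy

end Angle

section Profile

variable {r H : ℝ}

theorem profile_pos (hr : 0 < r) (h : H / r ∈ Ioo 1 (π / 2)) : 0 < profile r H :=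
  div_pos hr (sin_pos_of_mem (angle_mem h))

theorem profile_mul_sin (h : H / r ∈ Ioo 1 (π / 2)) : profile r H * sin (angle (H / r)) = r :=
  div_mul_cancel₀ _ (sin_pos_of_mem (angle_mem h)).ne'

theorem profile_mul_angle (hr : 0 < r) (h : H / r ∈ Ioo 1 (π / 2)) :
    profile r H * angle (H / r) = H := by
  have h1 := angle_div_sin h
  unfold profile
  rw [div_mul_eq_mul_div, mul_div_assoc, h1, mul_div_cancel₀ _ hr.ne']

theorem angle_polar {F θ : ℝ} (hF : 0 < F) (hθ : θ ∈ Ioo 0 (π / 2)) :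
    angle (F * θ / (F * sin θ)) = θ := by
  rw [mul_div_mul_left _ _ hF.ne', angle_of_div_sin hθ]

theorem profile_polar {F θ : ℝ} (hF : 0 < F) (hθ : θ ∈ Ioo 0 (π / 2)) :
    profile (F * sin θ) (F * θ) = F := by
  unfold profile
  rw [angle_polar hF hθ, mul_div_cancel_right₀ _ (sin_pos_of_mem hθ).ne']

theorem profile_smul {c : ℝ} (hc : c ≠ 0) : profile (c * r) (c * H) = c * profile r H := by
  unfold profile
  rw [mul_div_mul_left _ _ hc, mul_div_assoc]

variable {ρ η : ℝ → ℝ} {ρ' η' t : ℝ}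

theorem hasDerivAt_angle_div (hρ : HasDerivAt ρ ρ' t) (hη : HasDerivAt η η' t) (hpos : 0 < ρ t)
    (h : η t / ρ t ∈ Ioo 1 (π / 2)) :
    HasDerivAt (fun t => angle (η t / ρ t))
      ((η' * sin (angle (η t / ρ t)) - angle (η t / ρ t) * ρ') /
        (profile (ρ t) (η t) * gap (angle (η t / ρ t)))) t := by
  refine ((hasDerivAt_angle h).comp t (hη.div hρ hpos.ne')).congr_deriv ?_
  have e1 := profile_mul_sin h
  have e2 := profile_mul_angle hpos h
  have hF := profile_pos hpos h
  have hs := sin_pos_of_mem (angle_mem h)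
  have hg := gap_pos (angle_mem h)
  set θ := angle (η t / ρ t)
  set F := profile (ρ t) (η t)
  rw [← e1, ← e2]
  field_simp

theorem hasDerivAt_profile (hρ : HasDerivAt ρ ρ' t) (hη : HasDerivAt η η' t) (hpos : 0 < ρ t)
    (h : η t / ρ t ∈ Ioo 1 (π / 2)) :
    HasDerivAt (fun t => profile (ρ t) (η t))
      ((ρ' - cos (angle (η t / ρ t)) * η') / gap (angle (η t / ρ t))) t := by
  have hs := sin_pos_of_mem (angle_mem h)
  have hg := gap_pos (angle_mem h)
  refine (hρ.div (hasDerivAt_angle_div hρ hη hpos h).sin hs.ne').congr_deriv ?_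
  have e1 := profile_mul_sin h
  have hF := profile_pos hpos h
  set θ := angle (η t / ρ t)
  set F := profile (ρ t) (η t)
  rw [← e1]
  field_simp
  unfold gap; ring

/-- The second derivative of the profile along a curve. The term quadratic in the derivative of the
angle carries the strict convexity of the metric. -/
theorem hasDerivAt_deriv_profile {ρ₁ η₁ : ℝ → ℝ} {ρ₂ η₂ : ℝ} (hρ : HasDerivAt ρ (ρ₁ t) t)
    (hη : HasDerivAt η (η₁ t) t) (hρ₁ : HasDerivAt ρ₁ ρ₂ t) (hη₁ : HasDerivAt η₁ η₂ t)
    (hpos : 0 < ρ t) (h : η t / ρ t ∈ Ioo 1 (π / 2)) :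
    HasDerivAt (fun t => (ρ₁ t - cos (angle (η t / ρ t)) * η₁ t) / gap (angle (η t / ρ t)))
      ((ρ₂ - cos (angle (η t / ρ t)) * η₂) / gap (angle (η t / ρ t)) +
        profile (ρ t) (η t) * sin (angle (η t / ρ t)) / gap (angle (η t / ρ t)) *
          ((η₁ t * sin (angle (η t / ρ t)) - angle (η t / ρ t) * ρ₁ t) /
            (profile (ρ t) (η t) * gap (angle (η t / ρ t)))) ^ 2) t := by
  have hg := gap_pos (angle_mem h)
  have hθ := hasDerivAt_angle_div hρ hη hpos h
  refine ((hρ₁.sub (hθ.cos.mul hη₁)).div ((hasDerivAt_gap _).comp t hθ) hg.ne').congr_deriv ?_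
  have hF := profile_pos hpos h
  have e : sin (angle (η t / ρ t)) =
    gap (angle (η t / ρ t)) + angle (η t / ρ t) * cos (angle (η t / ρ t)) := by unfold gap; ring
  simp only [Function.comp, Pi.sub_apply, Pi.mul_apply]
  set θ := angle (η t / ρ t)
  set F := profile (ρ t) (η t)
  set g := gap θ
  field_simp
  rw [e]; ring

end Profile

/-! ### The primal metric -/

/-- Euclidean three-space. -/
abbrev E3 : Type := EuclideanSpace ℝ (Fin 3)

/-- The distance to the vertical axis. -/
noncomputable def radius (y : E3) : ℝ := √(y 0 ^ 2 + y 1 ^ 2)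

/-- The absolute height in units of `a`. -/
noncomputable def height (a : ℝ) (y : E3) : ℝ := |y 2| / a

/-- The cone over the surfaces of revolution `(sin θ cos φ, sin θ sin φ, ± a θ)` with
`0 < θ < π / 2`. -/
def cone (a : ℝ) : Set E3 := {y | 0 < radius y ∧ height a y / radius y ∈ Ioo 1 (π / 2)}

/-- The metric on `cone a` whose indicatrix is the pair of surfaces of revolution
`(sin θ cos φ, sin θ sin φ, ± a θ)` with `0 < θ < π / 2`. -/
noncomputable def metric (a : ℝ) (y : E3) : ℝ := profile (radius y) (height a y)

/-- The angle `θ` of the point `y / F(y)` of the indicatrix. -/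
noncomputable def coneAngle (a : ℝ) (y : E3) : ℝ := angle (height a y / radius y)

variable {a : ℝ} {y v : E3}

theorem continuous_radius : Continuous radius := by
  unfold radius; fun_prop

theorem continuous_height : Continuous (height a) := by
  unfold height; fun_prop

theorem radius_sq (y : E3) : radius y ^ 2 = y 0 ^ 2 + y 1 ^ 2 := sq_sqrt (by positivity)

theorem isOpen_cone (a : ℝ) : IsOpen (cone a) := by
  rw [isOpen_iff_mem_nhds]
  rintro y ⟨h0, h1⟩
  have hr : ContinuousAt radius y := continuous_radius.continuousAt
  have hq : ContinuousAt (fun y => height a y / radius y) y :=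
    continuous_height.continuousAt.div hr h0.ne'
  filter_upwards [hr.eventually_mem (isOpen_Ioi.mem_nhds h0),
    hq.eventually_mem (isOpen_Ioo.mem_nhds h1)] with z hz1 hz2 using ⟨hz1, hz2⟩

theorem radius_smul {t : ℝ} (ht : 0 < t) (y : E3) : radius (t • y) = t * radius y := by
  have : (t • y) 0 ^ 2 + (t • y) 1 ^ 2 = t ^ 2 * (y 0 ^ 2 + y 1 ^ 2) := by simp; ring
  unfold radius
  rw [this, sqrt_mul (sq_nonneg t), sqrt_sq ht.le]

theorem height_smul {t : ℝ} (ht : 0 < t) (y : E3) : height a (t • y) = t * height a y := by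
  unfold height
  simp [abs_mul, abs_of_pos ht, mul_div_assoc]

theorem smul_mem_cone {t : ℝ} (ht : 0 < t) (hy : y ∈ cone a) : t • y ∈ cone a := by
  refine ⟨by rw [radius_smul ht]; exact mul_pos ht hy.1, ?_⟩
  rw [radius_smul ht, height_smul ht, mul_div_mul_left _ _ ht.ne']
  exact hy.2

theorem third_ne_zero (hy : y ∈ cone a) : y 2 ≠ 0 := by
  intro h
  have := hy.2.1
  simp [height, h] at this
  linarith

theorem contDiffAt_apply (i : Fin 3) : ContDiffAt ℝ ∞ (fun y : E3 => y i) y :=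
  (EuclideanSpace.proj i : E3 →L[ℝ] ℝ).contDiff.contDiffAt

theorem contDiffAt_radius (hy : 0 < radius y) : ContDiffAt ℝ ∞ radius y := by
  refine ContDiffAt.sqrt (((contDiffAt_apply 0).pow 2).add ((contDiffAt_apply 1).pow 2)) ?_
  have := radius_sq y
  rw [← this]; positivity

theorem contDiffAt_height (hy : y 2 ≠ 0) : ContDiffAt ℝ ∞ (height a) y :=
  (((contDiffAt_abs (n := ⊤) hy).comp y (contDiffAt_apply 2)).div_const a :)

theorem contDiffAt_metric (hy : y ∈ cone a) : ContDiffAt ℝ ∞ (metric a) y := by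
  have hr := contDiffAt_radius hy.1
  have hq := (contDiffAt_height (a := a) (third_ne_zero hy)).div hr hy.1.ne'
  exact hr.div (contDiff_sin.contDiffAt.comp y ((contDiffAt_angle hy.2).comp y hq))
    (sin_pos_of_mem (angle_mem hy.2)).ne'

theorem coneAngle_mem (hy : y ∈ cone a) : coneAngle a y ∈ Ioo 0 (π / 2) := angle_mem hy.2

theorem metric_pos (hy : y ∈ cone a) : 0 < metric a y := profile_pos hy.1 hy.2

theorem metric_mul_sin (hy : y ∈ cone a) : metric a y * sin (coneAngle a y) = radius y :=
  profile_mul_sin hy.2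

theorem metric_mul_angle (hy : y ∈ cone a) : metric a y * coneAngle a y = height a y :=
  profile_mul_angle hy.1 hy.2

theorem hasDerivAt_radius_line {t : ℝ} (h : 0 < radius (y + t • v)) :
    HasDerivAt (fun t : ℝ => radius (y + t • v))
      (((y + t • v) 0 * v 0 + (y + t • v) 1 * v 1) / radius (y + t • v)) t := by
  have h0 : (y + t • v) 0 ^ 2 + (y + t • v) 1 ^ 2 ≠ 0 := by
    rw [← radius_sq]; positivity
  have hl (i : Fin 3) : HasDerivAt (fun t : ℝ => (y + t • v) i) (v i) t := by
    simpa using ((hasDerivAt_id t).mul_const (v i)).const_add (y i)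
  refine ((((hl 0).pow 2).add ((hl 1).pow 2)).sqrt h0).congr_deriv ?_
  simp only [Nat.cast_ofNat, Nat.add_one_sub_one, pow_one]
  change _ / (2 * radius (y + t • v)) = _
  rw [← mul_div_mul_left _ (radius (y + t • v)) two_ne_zero]
  ring

theorem hasDerivAt_radius_line_two (h : 0 < radius y) :
    HasDerivAt (fun t : ℝ => ((y + t • v) 0 * v 0 + (y + t • v) 1 * v 1) / radius (y + t • v))
      ((y 0 * v 1 - y 1 * v 0) ^ 2 / radius y ^ 3) 0 := by
  have hl (i : Fin 3) : HasDerivAt (fun t : ℝ => (y + t • v) i) (v i) 0 := by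
    simpa using ((hasDerivAt_id (0 : ℝ)).mul_const (v i)).const_add (y i)
  have hr := hasDerivAt_radius_line (y := y) (v := v) (t := 0) (by simpa using h)
  refine ((((hl 0).mul_const (v 0)).add ((hl 1).mul_const (v 1))).div hr (by simpa using h.ne')
    ).congr_deriv ?_
  have h2 := radius_sq y
  simp only [zero_smul, add_zero, Pi.add_apply]
  field_simp
  rw [h2]; ring

theorem hasDerivAt_height_line {t : ℝ} (h : (y + t • v) 2 ≠ 0) :
    HasDerivAt (fun t : ℝ => height a (y + t • v))
      (SignType.sign ((y + t • v) 2) * v 2 / a) t := by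
  have hl : HasDerivAt (fun t : ℝ => (y + t • v) 2) (v 2) t := by
    simpa using ((hasDerivAt_id t).mul_const (v 2)).const_add (y 2)
  exact ((hasDerivAt_abs h).comp t hl).div_const a

theorem hasDerivAt_metric_line {t : ℝ} (h : y + t • v ∈ cone a) :
    HasDerivAt (fun t : ℝ => metric a (y + t • v))
      ((((y + t • v) 0 * v 0 + (y + t • v) 1 * v 1) / radius (y + t • v) -
        cos (coneAngle a (y + t • v)) * (SignType.sign ((y + t • v) 2) * v 2 / a)) /
          gap (coneAngle a (y + t • v))) t :=
  hasDerivAt_profile (hasDerivAt_radius_line h.1) (hasDerivAt_height_line (third_ne_zero h)) h.1 h.2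

theorem fderiv_metric_apply (hy : y ∈ cone a) (v : E3) :
    fderiv ℝ (metric a) y v = ((y 0 * v 0 + y 1 * v 1) / radius y -
      cos (coneAngle a y) * (SignType.sign (y 2) * v 2 / a)) / gap (coneAngle a y) := by
  have h1 := ((contDiffAt_metric hy).differentiableAt (by simp)).hasFDerivAt
  have h2 : HasDerivAt (fun t : ℝ => y + t • v) v 0 := by
    simpa using ((hasDerivAt_id (0 : ℝ)).smul_const v).const_add y
  have h3 := h1.comp_hasDerivAt_of_eq 0 h2 (by simp)
  have h4 := hasDerivAt_metric_line (a := a) (y := y) (v := v) (t := 0) (by simpa using hy)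
  simp only [zero_smul, add_zero] at h4
  exact h3.unique h4

/-- The quadratic form `F' ^ 2 + F * F''` in the velocity `(v₀, v₁, η)` vanishes only at zero. -/
theorem second_variation_pos {θ F r y₀ y₁ v₀ v₁ η : ℝ} (hθ : θ ∈ Ioo 0 (π / 2)) (hF : 0 < F)
    (hr : 0 < r) (hr2 : r ^ 2 = y₀ ^ 2 + y₁ ^ 2) (hv : ¬ (η = 0 ∧ v₀ = 0 ∧ v₁ = 0)) :
    0 < (((y₀ * v₀ + y₁ * v₁) / r - cos θ * η) / gap θ) ^ 2 +
      F / gap θ * ((y₀ * v₁ - y₁ * v₀) ^ 2 / r ^ 3) + F ^ 2 * sin θ / gap θ *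
        ((η * sin θ - θ * ((y₀ * v₀ + y₁ * v₁) / r)) / (F * gap θ)) ^ 2 := by
  have hg := gap_pos hθ
  have hs := sin_pos_of_mem hθ
  have hgdef : gap θ = sin θ - θ * cos θ := rfl
  generalize gap θ = g at *
  generalize hd : ((y₀ * v₀ + y₁ * v₁) / r - cos θ * η) / g = d
  generalize hτ : (η * sin θ - θ * ((y₀ * v₀ + y₁ * v₁) / r)) / (F * g) = τ
  by_contra hcon
  have e1 : 0 ≤ d ^ 2 := sq_nonneg _
  have e2 : 0 ≤ F / g * ((y₀ * v₁ - y₁ * v₀) ^ 2 / r ^ 3) := by positivity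
  have e3 : 0 ≤ F ^ 2 * sin θ / g * τ ^ 2 := by positivity
  have hd0 : d ^ 2 = 0 := by linarith
  have hw0 : F / g * ((y₀ * v₁ - y₁ * v₀) ^ 2 / r ^ 3) = 0 := by linarith
  have hτ0 : F ^ 2 * sin θ / g * τ ^ 2 = 0 := by linarith
  have hd1 : (y₀ * v₀ + y₁ * v₁) / r - cos θ * η = 0 := by
    simpa [← hd, hg.ne'] using hd0
  have hw1 : y₀ * v₁ - y₁ * v₀ = 0 := by
    simpa [hF.ne', hg.ne', hr.ne'] using hw0
  have hτ1 : η * sin θ - θ * ((y₀ * v₀ + y₁ * v₁) / r) = 0 := by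
    simpa [← hτ, hF.ne', hg.ne', hs.ne'] using hτ0
  have hη : η = 0 := by
    have : η * g = 0 := by rw [hgdef]; linear_combination hτ1 + θ * hd1
    exact (mul_eq_zero.1 this).resolve_right hg.ne'
  have hu : y₀ * v₀ + y₁ * v₁ = 0 := by
    rw [hη] at hd1; simpa [hr.ne'] using hd1
  have hv01 : r ^ 2 * (v₀ ^ 2 + v₁ ^ 2) = 0 := by
    rw [hr2]; linear_combination (y₀ * v₀ + y₁ * v₁) * hu + (y₀ * v₁ - y₁ * v₀) * hw1
  have hv01' : v₀ ^ 2 + v₁ ^ 2 = 0 := (mul_eq_zero.1 hv01).resolve_left (by positivity)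
  have h0 : v₀ ^ 2 = 0 := by linarith [sq_nonneg v₀, sq_nonneg v₁]
  have h1 : v₁ ^ 2 = 0 := by linarith [sq_nonneg v₀, sq_nonneg v₁]
  exact hv ⟨hη, by simpa using h0, by simpa using h1⟩

/-- Positive definiteness: along a line, half the second derivative of `F ^ 2` is
`F' ^ 2 + F * F''`, and `F''` is the sum of a term from the curvature of the horizontal circle and
one from the curvature of the meridian `(sin θ, θ)`. -/
theorem fundamental_pos (ha : 0 < a) (hy : y ∈ cone a) (hv : v ≠ 0) :
    0 < (1 / 2 : ℝ) * fderiv ℝ (fderiv ℝ (fun z => metric a z ^ 2)) y v v := by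
  set D : ℝ → ℝ := fun t => (((y + t • v) 0 * v 0 + (y + t • v) 1 * v 1) / radius (y + t • v) -
        cos (coneAngle a (y + t • v)) * (SignType.sign (y 2) * v 2 / a)) /
          gap (coneAngle a (y + t • v)) with hD
  have hline (t : ℝ) : HasDerivAt (fun t : ℝ => y + t • v) v t := by
    simpa using ((hasDerivAt_id t).smul_const v).const_add y
  have hy0 : y + (0 : ℝ) • v = y := by simp
  have hcone : ∀ᶠ t : ℝ in 𝓝 0, y + t • v ∈ cone a :=
    (hline 0).continuousAt.eventually_mem ((isOpen_cone a).mem_nhds (by simpa using hy))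
  have hcoord : Continuous fun t : ℝ => (y + t • v) 2 := by fun_prop
  have hsign : ∀ᶠ t : ℝ in 𝓝 0, SignType.sign ((y + t • v) 2) = SignType.sign (y 2) := by
    rcases lt_or_gt_of_ne (third_ne_zero hy) with h | h
    · filter_upwards [hcoord.continuousAt.eventually_mem
        (isOpen_Iio.mem_nhds (by simpa using h : (y + (0 : ℝ) • v) 2 < 0))] with t ht
      rw [sign_neg ht, sign_neg h]
    · filter_upwards [hcoord.continuousAt.eventually_mem
        (isOpen_Ioi.mem_nhds (by simpa using h : 0 < (y + (0 : ℝ) • v) 2))] with t ht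
      rw [sign_pos ht, sign_pos h]
  have hQ {z : E3} (hz : z ∈ cone a) : ContDiffAt ℝ ∞ (fun z => metric a z ^ 2) z :=
    (contDiffAt_metric hz).pow 2
  have hfirst : ∀ᶠ t : ℝ in 𝓝 0,
      fderiv ℝ (fun z => metric a z ^ 2) (y + t • v) v = 2 * metric a (y + t • v) * D t := by
    filter_upwards [hcone, hsign] with t ht hs
    have h1 := ((hQ ht).differentiableAt (by simp)).hasFDerivAt.comp_hasDerivAt t (hline t)
    have h2 := (hasDerivAt_metric_line ht).pow 2
    rw [h1.unique h2, hs]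
    simp [hD]
  have hQ' : DifferentiableAt ℝ (fderiv ℝ (fun z => metric a z ^ 2)) y :=
    ((hQ hy).fderiv_right (m := 1) (by norm_cast)).differentiableAt (by simp)
  have hsecond : HasDerivAt (fun t : ℝ => fderiv ℝ (fun z => metric a z ^ 2) (y + t • v) v)
      (fderiv ℝ (fderiv ℝ (fun z => metric a z ^ 2)) y v v) 0 := by
    simpa using (hQ'.hasFDerivAt.comp_hasDerivAt_of_eq 0 (hline 0) (by simp)).clm_apply
      (hasDerivAt_const 0 v)
  have hF := hasDerivAt_metric_line (a := a) (y := y) (v := v) (t := 0) (by simpa using hy)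
  have hr0 : 0 < radius (y + (0 : ℝ) • v) := by simpa using hy.1
  have hη : HasDerivAt (fun t : ℝ => height a (y + t • v)) (SignType.sign (y 2) * v 2 / a) 0 := by
    simpa using hasDerivAt_height_line (a := a) (y := y) (v := v) (t := 0)
      (by simpa using third_ne_zero hy)
  have hDD : HasDerivAt D _ 0 := hasDerivAt_deriv_profile (hasDerivAt_radius_line hr0) hη
    (hasDerivAt_radius_line_two hy.1) (hasDerivAt_const 0 _) hr0 (by simpa using hy.2)
  rw [hsecond.unique (((hF.const_mul 2).mul hDD).congr_of_eventuallyEq hfirst)]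
  have hfold : angle (height a y / radius y) = coneAngle a y := rfl
  have hfold' : profile (radius y) (height a y) = metric a y := rfl
  simp only [hD, hy0, hfold, hfold']
  have hθ := coneAngle_mem hy
  have hF0 := metric_pos hy
  have hr := hy.1
  have hr2 := radius_sq y
  have hσ : ((SignType.sign (y 2) : SignType) : ℝ) ≠ 0 := by
    rcases lt_or_gt_of_ne (third_ne_zero hy) with h | h
    · simp [sign_neg h]
    · simp [sign_pos h]
  have hv' : ¬ (SignType.sign (y 2) * v 2 / a = 0 ∧ v 0 = 0 ∧ v 1 = 0) := by
    rintro ⟨h2, h0, h1⟩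
    apply hv
    ext i
    fin_cases i
    · simpa using h0
    · simpa using h1
    · simpa [hσ, ha.ne'] using h2
  calc 0 < _ := second_variation_pos hθ hF0 hr hr2 hv'
    _ = _ := by simp only [mul_zero, sub_zero]; ring

/-- Recognizing a point of the cone by its polar data. -/
theorem mem_cone_of_polar {F θ : ℝ} (hF : 0 < F) (hθ : θ ∈ Ioo 0 (π / 2))
    (hr : radius y = F * sin θ) (hh : height a y = F * θ) :
    y ∈ cone a ∧ metric a y = F ∧ coneAngle a y = θ := by
  refine ⟨⟨hr ▸ mul_pos hF (sin_pos_of_mem hθ), ?_⟩, ?_, ?_⟩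
  · rw [hr, hh, mul_div_mul_left _ _ hF.ne']
    exact div_sin_mem hθ
  · rw [metric, hr, hh, profile_polar hF hθ]
  · rw [coneAngle, hr, hh, angle_polar hF hθ]

theorem cone_nonempty (ha : 0 < a) : (cone a).Nonempty := by
  have hθ : (1 : ℝ) ∈ Ioo 0 (π / 2) := ⟨one_pos, by linarith [pi_gt_three]⟩
  refine ⟨!₂[sin 1, 0, a], (mem_cone_of_polar one_pos hθ ?_ ?_).1⟩
  · simp [radius, sqrt_sq (sin_pos_of_mem hθ).le]
  · simp [height, abs_of_pos ha, ha.ne']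

/-- The conic Minkowski metric `metric a` on `cone a`. -/
noncomputable def helicoidMetric (a : ℝ) (ha : 0 < a) : ConicMinkowskiMetric E3 where
  dom := cone a
  F := metric a
  isOpen_dom := isOpen_cone a
  nonempty_dom := cone_nonempty ha
  zero_notMem h := by simpa [radius] using h.1
  smul_mem _ ht _ hy := smul_mem_cone ht hy
  nonneg _ hy := (metric_pos hy).le
  smooth _ hy := (contDiffAt_metric hy).contDiffWithinAt
  homogeneous t ht y _ := by
    unfold metric
    rw [radius_smul ht, height_smul ht, profile_smul ht.ne']
  posDef _ hy _ hv := fundamental_pos ha hy hv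

end HelicoidMetric

/-! ### Legendre duality -/

namespace ConicMinkowskiMetric

variable {E : Type*} [NormedAddCommGroup E] [NormedSpace ℝ E] (M : ConicMinkowskiMetric E)
  {y : E}

theorem contDiffAt_F (hy : y ∈ M.dom) : ContDiffAt ℝ ∞ M.F y :=
  M.smooth.contDiffAt (M.isOpen_dom.mem_nhds hy)

theorem hasFDerivAt_F (hy : y ∈ M.dom) : HasFDerivAt M.F (fderiv ℝ M.F y) y :=
  ((M.contDiffAt_F hy).differentiableAt (by simp)).hasFDerivAt

theorem fderiv_F_self (hy : y ∈ M.dom) : fderiv ℝ M.F y y = M.F y := by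
  have h1 : HasDerivAt (fun t : ℝ => t • y) y 1 := by
    simpa using (hasDerivAt_id (1 : ℝ)).smul_const y
  have h2 := (M.hasFDerivAt_F hy).comp_hasDerivAt_of_eq 1 h1 (by simp)
  have h3 : HasDerivAt (fun t : ℝ => t * M.F y) (M.F y) 1 := by
    simpa using (hasDerivAt_id (1 : ℝ)).mul_const (M.F y)
  refine h2.unique (h3.congr_of_eventuallyEq ?_)
  filter_upwards [isOpen_Ioi.mem_nhds (zero_lt_one (α := ℝ))] with t ht
  exact M.homogeneous t ht y hy

theorem legendre_self (hy : y ∈ M.dom) : M.legendre y y = M.F y ^ 2 := by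
  simp [legendre, M.fderiv_F_self hy, sq]

theorem hasFDerivAt_F_sq (hy : y ∈ M.dom) :
    HasFDerivAt (fun z => M.F z ^ 2) ((2 : ℝ) • M.legendre y) y := by
  refine ((M.hasFDerivAt_F hy).pow 2).congr_fderiv ?_
  ext v
  simp [legendre]; ring

/-- The differential of the Legendre transformation is the fundamental tensor. -/
theorem hasFDerivAt_legendre (hy : y ∈ M.dom) :
    HasFDerivAt M.legendre ((1 / 2 : ℝ) • fderiv ℝ (fderiv ℝ (fun z => M.F z ^ 2)) y) y := by
  have h : DifferentiableAt ℝ (fderiv ℝ (fun z => M.F z ^ 2)) y :=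
    (((M.contDiffAt_F hy).pow 2).fderiv_right (m := 1) (by norm_cast)).differentiableAt (by simp)
  refine (h.hasFDerivAt.const_smul (1 / 2 : ℝ)).congr_of_eventuallyEq ?_
  filter_upwards [M.isOpen_dom.mem_nhds hy] with z hz
  simp [(M.hasFDerivAt_F_sq hz).fderiv]

variable {M}

theorem HasDual.legendreInv_legendre {As : Set (StrongDual ℝ E)} {Fs : StrongDual ℝ E → ℝ}
    (h : M.HasDual As Fs) (hy : y ∈ M.dom) : M.legendreInv (M.legendre y) = y :=
  h.applicable.leftInvOn_invFunOn hy

/-- A point is determined by its Legendre transform `ξ` and the dual metric: it is `F* dF*` at `ξ`.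
Differentiate `F*(L(z)) ^ 2 = F(z) ^ 2 = L(z)(z)` and use that `D L` is onto. -/
theorem HasDual.apply_eq [FiniteDimensional ℝ E] {As : Set (StrongDual ℝ E)}
    {Fs : StrongDual ℝ E → ℝ} (h : M.HasDual As Fs) (hy : y ∈ M.dom)
    (hFs : DifferentiableAt ℝ Fs (M.legendre y)) (η : StrongDual ℝ E) :
    η y = Fs (M.legendre y) * fderiv ℝ Fs (M.legendre y) η := by
  set G : E →L[ℝ] StrongDual ℝ E :=
    (1 / 2 : ℝ) • fderiv ℝ (fderiv ℝ (fun z => M.F z ^ 2)) y with hG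
  have hL : HasFDerivAt M.legendre G y := M.hasFDerivAt_legendre hy
  have hinj : Function.Injective (G : E →ₗ[ℝ] StrongDual ℝ E) := by
    rw [← LinearMap.ker_eq_bot, LinearMap.ker_eq_bot']
    intro v hv
    by_contra hne
    have h1 := M.posDef y hy v hne
    have h2 : G v v = 0 := by
      have : G v = 0 := hv
      simp [this]
    simp only [hG, smul_apply, smul_eq_mul] at h2
    linarith
  have hfin : Module.finrank ℝ E = Module.finrank ℝ (StrongDual ℝ E) := by
    rw [← (LinearMap.toContinuousLinearMap (𝕜 := ℝ) (E := E) (F' := ℝ)).finrank_eq]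
    exact (Subspace.dual_finrank_eq (K := ℝ) (V := E)).symm
  obtain ⟨v, rfl⟩ : ∃ v, G v = η :=
    (LinearMap.injective_iff_surjective_of_finrank_eq_finrank hfin).1 hinj η
  have hnhds := M.isOpen_dom.mem_nhds hy
  have hsq := M.hasFDerivAt_F_sq hy
  have e1 := ((hFs.hasFDerivAt.pow 2).comp y hL).unique (hsq.congr_of_eventuallyEq (by
    filter_upwards [hnhds] with z hz
    have hz' : M.legendre z ∈ As := h.dualDom_eq ▸ mem_image_of_mem _ hz
    have := h.dualMetric_eq hz'
    rw [dualMetric, h.legendreInv_legendre hz] at this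
    simp [this]))
  have e2 := (hL.clm_apply (hasFDerivAt_id y)).unique (hsq.congr_of_eventuallyEq (by
    filter_upwards [hnhds] with z hz using M.legendre_self hz))
  have e1' := congrArg (fun A : E →L[ℝ] ℝ => A v) e1
  have e2' := congrArg (fun A : E →L[ℝ] ℝ => A v) e2
  simp at e1' e2'
  linarith

/-- Two metrics with the same differentiable dual metric agree. -/
theorem HasDual.subset_of_hasDual [FiniteDimensional ℝ E] {M' : ConicMinkowskiMetric E}
    {As : Set (StrongDual ℝ E)} {Fs : StrongDual ℝ E → ℝ} (h : M.HasDual As Fs)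
    (h' : M'.HasDual As Fs) (hFs : ∀ ξ ∈ As, DifferentiableAt ℝ Fs ξ)
    (hy : y ∈ M.dom) : y ∈ M'.dom ∧ M'.F y = M.F y ∧ M'.legendre y = M.legendre y := by
  have hξ : M.legendre y ∈ As := h.dualDom_eq ▸ mem_image_of_mem _ hy
  obtain ⟨z, hz, hzy⟩ : M.legendre y ∈ M'.dualDom := h'.dualDom_eq.symm ▸ hξ
  have hyz : y = z := by
    refine (SeparatingDual.eq_iff_forall_dual_eq (R := ℝ)).2 fun η => ?_
    rw [h.apply_eq hy (hFs _ hξ), h'.apply_eq hz (hzy ▸ hFs _ hξ), hzy]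
  subst hyz
  refine ⟨hz, ?_, hzy⟩
  have e1 := h.dualMetric_eq hξ
  have e2 := h'.dualMetric_eq hξ
  rw [dualMetric, h.legendreInv_legendre hy] at e1
  rw [dualMetric, ← hzy, h'.legendreInv_legendre hz] at e2
  rw [e1, e2, hzy]

end ConicMinkowskiMetric

namespace HelicoidMetric

open Real Filter Topology

/-! ### The dual metric in coordinates -/

/-- The coordinates of a covector. -/
noncomputable def coord (i : Fin 3) : StrongDual ℝ E3 →L[ℝ] ℝ :=
  ContinuousLinearMap.apply ℝ ℝ (EuclideanSpace.single i 1)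

/-- The Euclidean length of the horizontal part of a covector. -/
noncomputable def coradius (ξ : StrongDual ℝ E3) : ℝ := √(coord 0 ξ ^ 2 + coord 1 ξ ^ 2)

variable {a b : ℝ} {ξ : StrongDual ℝ E3} {y v : E3}

theorem dual_apply (ξ : StrongDual ℝ E3) (v : E3) :
    ξ v = coord 0 ξ * v 0 + coord 1 ξ * v 1 + coord 2 ξ * v 2 := by
  have hv : v = v 0 • EuclideanSpace.single 0 1 + v 1 • EuclideanSpace.single 1 1 +
      v 2 • EuclideanSpace.single 2 1 := by
    ext i; fin_cases i <;> simp
  conv_lhs => rw [hv]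
  simp only [map_add, map_smul, smul_eq_mul, coord, ContinuousLinearMap.apply_apply]
  ring

theorem coord_eq_inner (ξ : StrongDual ℝ E3) (i : Fin 3) :
    coord i ξ = (InnerProductSpace.toDual ℝ E3).symm ξ i := by
  rw [coord, ContinuousLinearMap.apply_apply, ← InnerProductSpace.toDual_symm_apply (𝕜 := ℝ),
    EuclideanSpace.inner_single_right]
  simp

theorem dual_norm_sq (ξ : StrongDual ℝ E3) :
    ‖ξ‖ ^ 2 = coord 0 ξ ^ 2 + coord 1 ξ ^ 2 + coord 2 ξ ^ 2 := by
  rw [← (InnerProductSpace.toDual ℝ E3).symm.norm_map ξ, EuclideanSpace.norm_sq_eq]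
  simp [coord_eq_inner, Fin.sum_univ_three]

theorem coradius_sq (ξ : StrongDual ℝ E3) : coradius ξ ^ 2 = coord 0 ξ ^ 2 + coord 1 ξ ^ 2 :=
  sq_sqrt (by positivity)

theorem apply_betaStar (ξ : StrongDual ℝ E3) : ξ (betaStar b) = b * coord 2 ξ := by
  rw [dual_apply]; simp [betaStar]; ring

theorem mem_helicoidDualDom (ha : 0 < a) (hb : 0 < b) :
    ξ ∈ helicoidDualDom a b ↔ coord 2 ξ ≠ 0 ∧ a * |coord 2 ξ| < coradius ξ := by
  have hn := dual_norm_sq ξ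
  have hc := coradius_sq ξ
  have hc0 : 0 ≤ coradius ξ := sqrt_nonneg _
  have hw : 0 < √(1 + a ^ 2) := sqrt_pos.2 (by positivity)
  have hw2 : √(1 + a ^ 2) ^ 2 = 1 + a ^ 2 := sq_sqrt (by positivity)
  unfold helicoidDualDom
  rw [mem_ofPred_eq, apply_betaStar, abs_pos]
  by_cases h2 : coord 2 ξ = 0
  · simp [h2]
  · have hξ : 0 < ‖ξ‖ := by
      refine (norm_nonneg ξ).lt_of_ne' fun h => h2 ?_
      rw [h] at hn
      nlinarith [sq_nonneg (coord 0 ξ), sq_nonneg (coord 1 ξ), sq_nonneg (coord 2 ξ)]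
    have hsq : |coord 2 ξ| ^ 2 = coord 2 ξ ^ 2 := sq_abs _
    rw [abs_div, abs_mul, abs_of_pos hb, abs_of_pos hξ, div_lt_div_iff₀ hξ hw, mul_assoc,
      mul_lt_mul_iff_right₀ hb]
    refine and_congr (by simp [h2, hb.ne', hξ.ne']) ?_
    rw [← pow_lt_pow_iff_left₀ (by positivity) hξ.le two_ne_zero,
      ← pow_lt_pow_iff_left₀ (by positivity : 0 ≤ a * |coord 2 ξ|) hc0 two_ne_zero, mul_pow, mul_pow,
      hw2, hsq, hn, hc]
    constructor <;> intro h <;> linarith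

theorem coradius_pos (ha : 0 < a) (hξ : a * |coord 2 ξ| < coradius ξ) : 0 < coradius ξ :=
  lt_of_le_of_lt (by positivity) hξ

theorem arccos_mem (ha : 0 < a) (h2 : coord 2 ξ ≠ 0) (hξ : a * |coord 2 ξ| < coradius ξ) :
    arccos (a * |coord 2 ξ| / coradius ξ) ∈ Ioo 0 (π / 2) := by
  have hρ := coradius_pos ha hξ
  have h2' : 0 < |coord 2 ξ| := abs_pos.2 h2
  refine ⟨arccos_pos.2 ((div_lt_one hρ).2 hξ), arccos_lt_pi_div_two.2 (by positivity)⟩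

theorem cos_arccos_div (ha : 0 < a) (hξ : a * |coord 2 ξ| < coradius ξ) :
    cos (arccos (a * |coord 2 ξ| / coradius ξ)) = a * |coord 2 ξ| / coradius ξ := by
  have hρ := coradius_pos ha hξ
  exact cos_arccos (by linarith [show 0 ≤ a * |coord 2 ξ| / coradius ξ by positivity])
    ((div_lt_one hρ).2 hξ).le

/-- The dual metric in coordinates; the arc tangent in `helicoidPhi` is turned into the angle
`θ = arccos (a |ξ₂| / |(ξ₀, ξ₁)|)`. -/
theorem helicoidDualMetric_eq (ha : 0 < a) (hb : 0 < b) (h2 : coord 2 ξ ≠ 0)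
    (hξ : a * |coord 2 ξ| < coradius ξ) : helicoidDualMetric a b ξ =
      coradius ξ * gap (arccos (a * |coord 2 ξ| / coradius ξ)) := by
  have hρ := coradius_pos ha hξ
  have h2' : 0 < |coord 2 ξ| := abs_pos.2 h2
  have hn := dual_norm_sq ξ
  have hc := coradius_sq ξ
  have hξ0 : 0 < ‖ξ‖ := by
    refine (norm_nonneg ξ).lt_of_ne' fun h => hρ.ne' ?_
    rw [h] at hn
    nlinarith [sq_nonneg (coord 2 ξ)]
  have hsq : |coord 2 ξ| ^ 2 = coord 2 ξ ^ 2 := sq_abs _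
  set w : ℝ := √(coradius ξ ^ 2 - (a * coord 2 ξ) ^ 2)
  have hroot : √(b ^ 2 - (1 + a ^ 2) * (b * coord 2 ξ / ‖ξ‖) ^ 2) = b * w / ‖ξ‖ := by
    have : b ^ 2 - (1 + a ^ 2) * (b * coord 2 ξ / ‖ξ‖) ^ 2 =
        (b / ‖ξ‖) ^ 2 * (coradius ξ ^ 2 - (a * coord 2 ξ) ^ 2) := by
      field_simp
      rw [hn, hc]; ring
    rw [this, sqrt_mul (by positivity), sqrt_sq (by positivity)]
    ring
  have hsin : √(1 - (a * |coord 2 ξ| / coradius ξ) ^ 2) = w / coradius ξ := by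
    have : 1 - (a * |coord 2 ξ| / coradius ξ) ^ 2 =
        (coradius ξ ^ 2 - (a * coord 2 ξ) ^ 2) / coradius ξ ^ 2 := by
      field_simp
      rw [hsq]
    rw [this, sqrt_div' _ (by positivity), sqrt_sq hρ.le]
  have harc : arccos (a * |coord 2 ξ| / coradius ξ) = arctan (w / (a * |coord 2 ξ|)) := by
    rw [arccos_eq_arctan (by positivity), hsin]
    congr 1
    field_simp
  have hodd : |coord 2 ξ| * arctan (w / (a * |coord 2 ξ|)) =
      coord 2 ξ * arctan (w / (a * coord 2 ξ)) := by
    rcases lt_or_gt_of_ne h2 with h | h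
    · rw [abs_of_neg h, mul_neg, div_neg, arctan_neg]; ring
    · rw [abs_of_pos h]
  have hq : b * w / ‖ξ‖ / (a * (b * coord 2 ξ / ‖ξ‖)) = w / (a * coord 2 ξ) := by
    field_simp
  unfold helicoidDualMetric helicoidPhi gap
  rw [sin_arccos, hsin, cos_arccos_div ha hξ, harc, apply_betaStar, hroot, hq]
  field_simp
  linear_combination a * hodd

theorem differentiableAt_helicoidDualMetric (ha : 0 < a) (hb : 0 < b)
    (hξ : ξ ∈ helicoidDualDom a b) : DifferentiableAt ℝ (helicoidDualMetric a b) ξ := by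
  obtain ⟨h2, h⟩ := (mem_helicoidDualDom ha hb).1 hξ
  have hρ := coradius_pos ha h
  have hcont : Continuous coradius := by unfold coradius; fun_prop
  have hev : helicoidDualMetric a b =ᶠ[𝓝 ξ] fun ξ =>
      coradius ξ * gap (arccos (a * |coord 2 ξ| / coradius ξ)) := by
    have e1 : ∀ᶠ ζ in 𝓝 ξ, coord 2 ζ ≠ 0 :=
      (coord 2).continuous.continuousAt.eventually_ne h2
    have e2 : ∀ᶠ ζ in 𝓝 ξ, a * |coord 2 ζ| < coradius ζ :=
      ContinuousAt.eventually_lt (by fun_prop) hcont.continuousAt h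
    filter_upwards [e1, e2] with ζ h1 h2 using helicoidDualMetric_eq ha hb h1 h2
  refine DifferentiableAt.congr_of_eventuallyEq ?_ hev
  have hd : DifferentiableAt ℝ coradius ξ := by
    refine DifferentiableAt.sqrt (by fun_prop) ?_
    rw [← coradius_sq]; positivity
  have habs : DifferentiableAt ℝ (fun ζ => |coord 2 ζ|) ξ :=
    (differentiableAt_abs h2).comp ξ (coord 2).differentiableAt
  have hq : DifferentiableAt ℝ (fun ζ => a * |coord 2 ζ| / coradius ζ) ξ := by
    simpa only [div_eq_mul_inv] using (habs.const_mul a).fun_mul (hd.fun_inv hρ.ne')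
  have hc : DifferentiableAt ℝ arccos (a * |coord 2 ξ| / coradius ξ) :=
    differentiableAt_arccos.2
      ⟨by have : 0 ≤ a * |coord 2 ξ| / coradius ξ := by positivity
          linarith, ((div_lt_one hρ).2 h).ne⟩
  have hθ : DifferentiableAt ℝ (fun ζ => arccos (a * |coord 2 ζ| / coradius ζ)) ξ :=
    DifferentiableAt.comp (g := arccos) ξ hc hq
  exact hd.mul ((hasDerivAt_gap _).differentiableAt.comp ξ hθ)

/-! ### Duality of the two metrics -/

theorem legendre_apply (ha : 0 < a) (hy : y ∈ cone a) (v : E3) :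
    (helicoidMetric a ha).legendre y v = metric a y / gap (coneAngle a y) *
      ((y 0 * v 0 + y 1 * v 1) / radius y -
        cos (coneAngle a y) * (SignType.sign (y 2) * v 2 / a)) := by
  change metric a y * fderiv ℝ (metric a) y v = _
  rw [fderiv_metric_apply hy]
  ring

theorem coord_legendre (ha : 0 < a) (hy : y ∈ cone a) :
    coord 0 ((helicoidMetric a ha).legendre y) =
        metric a y / gap (coneAngle a y) * (y 0 / radius y) ∧
      coord 1 ((helicoidMetric a ha).legendre y) =
        metric a y / gap (coneAngle a y) * (y 1 / radius y) ∧
      coord 2 ((helicoidMetric a ha).legendre y) =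
        -(metric a y / gap (coneAngle a y) * (cos (coneAngle a y) * (SignType.sign (y 2) / a))) := by
  refine ⟨?_, ?_, ?_⟩ <;>
    simp only [coord, ContinuousLinearMap.apply_apply, legendre_apply ha hy] <;> simp

theorem abs_sign_eq_one {x : ℝ} (hx : x ≠ 0) : |((SignType.sign x : SignType) : ℝ)| = 1 := by
  rcases lt_or_gt_of_ne hx with h | h
  · simp [sign_neg h]
  · simp [sign_pos h]

theorem coradius_legendre (ha : 0 < a) (hy : y ∈ cone a) :
    coradius ((helicoidMetric a ha).legendre y) = metric a y / gap (coneAngle a y) := by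
  obtain ⟨h0, h1, -⟩ := coord_legendre ha hy
  have hF := metric_pos hy
  have hg := gap_pos (coneAngle_mem hy)
  have hr := hy.1
  have : coord 0 ((helicoidMetric a ha).legendre y) ^ 2 +
      coord 1 ((helicoidMetric a ha).legendre y) ^ 2 =
      (metric a y / gap (coneAngle a y)) ^ 2 := by
    rw [h0, h1]
    field_simp
    rw [radius_sq]
  rw [coradius, this, sqrt_sq (by positivity)]

theorem abs_coord_two_legendre (ha : 0 < a) (hy : y ∈ cone a) :
    a * |coord 2 ((helicoidMetric a ha).legendre y)| =
      metric a y / gap (coneAngle a y) * cos (coneAngle a y) := by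
  obtain ⟨-, -, h2⟩ := coord_legendre ha hy
  have hF := metric_pos hy
  have hg := gap_pos (coneAngle_mem hy)
  have hc := cos_pos_of_mem (coneAngle_mem hy)
  rw [h2, abs_neg, abs_mul, abs_mul, abs_div _ a, abs_sign_eq_one (third_ne_zero hy),
    abs_of_pos ha, abs_of_pos hc, abs_of_pos (div_pos hF hg)]
  field_simp

theorem coneAngle_eq_arccos (ha : 0 < a) (hy : y ∈ cone a) :
    arccos (a * |coord 2 ((helicoidMetric a ha).legendre y)| /
      coradius ((helicoidMetric a ha).legendre y)) = coneAngle a y := by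
  have hF := metric_pos hy
  have hθ := coneAngle_mem hy
  have hg := gap_pos hθ
  rw [coradius_legendre ha hy, abs_coord_two_legendre ha hy, mul_div_cancel_left₀ _ (by positivity),
    arccos_cos hθ.1.le (by linarith [hθ.2, pi_pos])]

theorem legendre_mem (ha : 0 < a) (hb : 0 < b) (hy : y ∈ cone a) :
    (helicoidMetric a ha).legendre y ∈ helicoidDualDom a b ∧
      helicoidDualMetric a b ((helicoidMetric a ha).legendre y) = metric a y := by
  have hF := metric_pos hy
  have hθ := coneAngle_mem hy
  have hg := gap_pos hθ
  have hc := cos_pos_of_mem hθ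
  have h2 : coord 2 ((helicoidMetric a ha).legendre y) ≠ 0 := by
    intro h
    have := abs_coord_two_legendre ha hy
    rw [h, abs_zero, mul_zero] at this
    have : 0 < metric a y / gap (coneAngle a y) * cos (coneAngle a y) := by positivity
    linarith
  have hlt : a * |coord 2 ((helicoidMetric a ha).legendre y)| <
      coradius ((helicoidMetric a ha).legendre y) := by
    rw [coradius_legendre ha hy, abs_coord_two_legendre ha hy]
    have : cos (coneAngle a y) < 1 := by
      rw [← cos_zero]
      exact cos_lt_cos_of_nonneg_of_le_pi le_rfl (by linarith [hθ.2, pi_pos]) hθ.1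
    exact mul_lt_of_lt_one_right (by positivity) this
  refine ⟨(mem_helicoidDualDom ha hb).2 ⟨h2, hlt⟩, ?_⟩
  rw [helicoidDualMetric_eq ha hb h2 hlt, coneAngle_eq_arccos ha hy, coradius_legendre ha hy]
  field_simp

theorem legendre_injOn (ha : 0 < a) : InjOn (helicoidMetric a ha).legendre (cone a) := by
  intro y hy z hz hyz
  have hθ : coneAngle a y = coneAngle a z := by
    rw [← coneAngle_eq_arccos ha hy, ← coneAngle_eq_arccos ha hz, hyz]
  have hg := gap_pos (coneAngle_mem hz)
  have hF : metric a y = metric a z := by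
    have := coradius_legendre ha hy
    rw [hyz, coradius_legendre ha hz, hθ, div_left_inj' hg.ne'] at this
    exact this.symm
  have hF0 := metric_pos hz
  have hc := cos_pos_of_mem (coneAngle_mem hz)
  have hr : radius y = radius z := by
    rw [← metric_mul_sin hy, ← metric_mul_sin hz, hF, hθ]
  have hr0 := hz.1
  have hh : |y 2| = |z 2| := by
    have : height a y = height a z := by
      rw [← metric_mul_angle hy, ← metric_mul_angle hz, hF, hθ]
    simpa [height, ha.ne'] using this
  obtain ⟨y0, y1, y2⟩ := coord_legendre ha hy
  obtain ⟨z0, z1, z2⟩ := coord_legendre ha hz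
  rw [hyz, z0, hF, hθ, hr] at y0
  rw [hyz, z1, hF, hθ, hr] at y1
  rw [hyz, z2, hF, hθ] at y2
  have hne : metric a z / gap (coneAngle a z) ≠ 0 := by positivity
  have e0 := mul_left_cancel₀ hne y0
  have e1 := mul_left_cancel₀ hne y1
  have e2 := mul_left_cancel₀ hc.ne' (mul_left_cancel₀ hne (neg_injective y2))
  rw [div_left_inj' hr0.ne'] at e0 e1
  rw [div_left_inj' ha.ne'] at e2
  ext i
  fin_cases i
  · exact e0.symm
  · exact e1.symm
  · change y 2 = z 2
    rw [← sign_mul_abs (y 2), ← sign_mul_abs (z 2), hh, e2]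

theorem exists_legendre_eq (ha : 0 < a) (h2 : coord 2 ξ ≠ 0) (h : a * |coord 2 ξ| < coradius ξ) :
    ∃ y ∈ cone a, (helicoidMetric a ha).legendre y = ξ := by
  have hρ := coradius_pos ha h
  have hθ := arccos_mem ha h2 h
  have hcos := cos_arccos_div ha h
  set θ := arccos (a * |coord 2 ξ| / coradius ξ)
  have hg := gap_pos hθ
  have hs := sin_pos_of_mem hθ
  set F := coradius ξ * gap θ with hFdef
  have hF : 0 < F := by positivity
  set y : E3 := !₂[F * sin θ * (coord 0 ξ / coradius ξ), F * sin θ * (coord 1 ξ / coradius ξ),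
    -(SignType.sign (coord 2 ξ) * (a * (F * θ)))]
  have y0 : y 0 = F * sin θ * (coord 0 ξ / coradius ξ) := rfl
  have y1 : y 1 = F * sin θ * (coord 1 ξ / coradius ξ) := rfl
  have y2 : y 2 = -(SignType.sign (coord 2 ξ) * (a * (F * θ))) := rfl
  have hpos : 0 < a * (F * θ) := mul_pos ha (mul_pos hF hθ.1)
  have hr : radius y = F * sin θ := by
    have : y 0 ^ 2 + y 1 ^ 2 = (F * sin θ) ^ 2 := by
      rw [y0, y1]
      field_simp
      rw [coradius_sq]
    rw [radius, this, sqrt_sq (by positivity)]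
  have hh : height a y = F * θ := by
    rw [height, y2, abs_neg, abs_mul, abs_sign_eq_one h2, one_mul, abs_of_pos hpos,
      mul_div_cancel_left₀ _ ha.ne']
  have hsign : SignType.sign (y 2) = -SignType.sign (coord 2 ξ) := by
    rw [y2, Left.sign_neg, sign_mul, sign_pos hpos, mul_one]
    rcases lt_or_gt_of_ne h2 with h | h
    · simp [sign_neg h]
    · simp [sign_pos h]
  obtain ⟨hmem, hFy, hθy⟩ := mem_cone_of_polar hF hθ hr hh
  refine ⟨y, hmem, ?_⟩
  ext v
  rw [legendre_apply ha hmem, dual_apply, hFy, hθy, hr, hsign, y0, y1, hcos, hFdef]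
  have := sign_mul_abs (coord 2 ξ)
  have hgap : coradius ξ * gap θ / gap θ = coradius ξ := mul_div_cancel_right₀ _ hg.ne'
  rw [hgap]
  push_cast
  field_simp
  linear_combination v 2 * this

theorem hasDual (ha : 0 < a) (hb : 0 < b) :
    (helicoidMetric a ha).HasDual (helicoidDualDom a b) (helicoidDualMetric a b) := by
  have hdom : (helicoidMetric a ha).dualDom = helicoidDualDom a b := by
    apply Subset.antisymm
    · rintro _ ⟨y, hy, rfl⟩
      exact (legendre_mem ha hb hy).1
    · intro ξ hξ
      obtain ⟨h2, h⟩ := (mem_helicoidDualDom ha hb).1 hξ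
      obtain ⟨y, hy, rfl⟩ := exists_legendre_eq ha h2 h
      exact mem_image_of_mem _ hy
  refine ⟨legendre_injOn ha, hdom, fun ξ hξ => ?_⟩
  rw [← hdom] at hξ
  obtain ⟨y, hy, rfl⟩ := hξ
  rw [(legendre_mem ha hb hy).2]
  exact congrArg (metric a) ((legendre_injOn ha).leftInvOn_invFunOn hy)

/-! ### The metric as an `(α, β)`-metric -/

/-- The distance to the axis of a Euclidean unit vector `y` with `β y = s`. -/
noncomputable def unitRadius (b s : ℝ) : ℝ := √(1 - (s / b) ^ 2)

/-- The function `ψ` with `F = α ψ(β / α)`. -/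
noncomputable def alphaBetaProfile (a b s : ℝ) : ℝ := profile (unitRadius b s) (|s| / (a * b))

/-- The angle of a unit vector `y` with `β y = s`. -/
noncomputable def alphaBetaAngle (a b s : ℝ) : ℝ := angle (|s| / (a * b) / unitRadius b s)

/-- The values of `β / α` on the cone. -/
def slopes (a b : ℝ) : Set ℝ :=
  {s | 0 < unitRadius b s ∧ |s| / (a * b) / unitRadius b s ∈ Ioo 1 (π / 2)}

variable {a b s : ℝ} {y : E3}

theorem sq_lt_of_unitRadius_pos (hb : 0 < b) (h : 0 < unitRadius b s) :
    unitRadius b s ^ 2 = 1 - (s / b) ^ 2 ∧ s ^ 2 < b ^ 2 := by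
  have h0 : 0 < 1 - (s / b) ^ 2 := sqrt_pos.1 h
  refine ⟨sq_sqrt h0.le, ?_⟩
  rw [div_pow, sub_pos, div_lt_one (by positivity)] at h0
  exact h0

theorem ne_zero_of_mem_slopes (hs : s ∈ slopes a b) : s ≠ 0 := by
  rintro rfl
  have := hs.2.1
  simp at this
  linarith

theorem isOpen_slopes (a b : ℝ) : IsOpen (slopes a b) := by
  rw [isOpen_iff_mem_nhds]
  rintro s ⟨h0, h1⟩
  have hr : ContinuousAt (unitRadius b) s := by unfold unitRadius; fun_prop
  have hq : ContinuousAt (fun s => |s| / (a * b) / unitRadius b s) s :=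
    ContinuousAt.div (by fun_prop) hr h0.ne'
  filter_upwards [hr.eventually_mem (isOpen_Ioi.mem_nhds h0),
    hq.eventually_mem (isOpen_Ioo.mem_nhds h1)] with z hz1 hz2 using ⟨hz1, hz2⟩

theorem slopes_subset (hb : 0 < b) : slopes a b ⊆ Icc (-b) b := fun _ hs =>
  abs_le.1 (abs_le_of_sq_le_sq (sq_lt_of_unitRadius_pos hb hs.1).2.le hb.le)

theorem hasDerivAt_unitRadius (h : 0 < unitRadius b s) :
    HasDerivAt (unitRadius b) (-(s / b ^ 2) / unitRadius b s) s := by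
  have h0 : 1 - (s / b) ^ 2 ≠ 0 := (sqrt_pos.1 h).ne'
  refine (((((hasDerivAt_id s).div_const b).pow 2).const_sub 1).sqrt h0).congr_deriv ?_
  change _ / (2 * unitRadius b s) = _
  simp only [id, Nat.cast_ofNat, Nat.add_one_sub_one, pow_one]
  rw [← mul_div_mul_left _ (unitRadius b s) two_ne_zero]
  ring

theorem hasDerivAt_unitRadius_two (hb : 0 < b) (h : 0 < unitRadius b s) :
    HasDerivAt (fun s => -(s / b ^ 2) / unitRadius b s) (-1 / (b ^ 2 * unitRadius b s ^ 3)) s := by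
  refine ((((hasDerivAt_id s).div_const (b ^ 2)).neg).div (hasDerivAt_unitRadius h) h.ne'
    ).congr_deriv ?_
  have := (sq_lt_of_unitRadius_pos hb h).1
  simp only [id, Pi.neg_apply]
  field_simp
  rw [this]
  field_simp
  ring

theorem hasDerivAt_abs_div (hs : s ≠ 0) :
    HasDerivAt (fun s => |s| / (a * b)) (SignType.sign s / (a * b)) s :=
  (hasDerivAt_abs hs).div_const _

theorem hasDerivAt_sign_div (hs : s ≠ 0) :
    HasDerivAt (fun s : ℝ => (SignType.sign s : ℝ) / (a * b)) 0 s := by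
  refine (hasDerivAt_const s ((SignType.sign s : ℝ) / (a * b))).congr_of_eventuallyEq ?_
  rcases lt_or_gt_of_ne hs with h | h
  · filter_upwards [isOpen_Iio.mem_nhds h] with t ht
    rw [sign_neg h, sign_neg ht]
  · filter_upwards [isOpen_Ioi.mem_nhds h] with t ht
    rw [sign_pos h, sign_pos ht]

/-- The first derivative of `alphaBetaProfile`. -/
noncomputable def alphaBetaDeriv (a b s : ℝ) : ℝ :=
  (-(s / b ^ 2) / unitRadius b s - cos (alphaBetaAngle a b s) * (SignType.sign s / (a * b))) /
    gap (alphaBetaAngle a b s)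

theorem hasDerivAt_alphaBetaProfile (hs : s ∈ slopes a b) :
    HasDerivAt (alphaBetaProfile a b) (alphaBetaDeriv a b s) s :=
  hasDerivAt_profile (hasDerivAt_unitRadius hs.1) (hasDerivAt_abs_div (ne_zero_of_mem_slopes hs))
    hs.1 hs.2

theorem hasDerivAt_alphaBetaDeriv (hb : 0 < b) (hs : s ∈ slopes a b) :
    HasDerivAt (alphaBetaDeriv a b)
      ((-1 / (b ^ 2 * unitRadius b s ^ 3) - cos (alphaBetaAngle a b s) * 0) /
        gap (alphaBetaAngle a b s) +
        alphaBetaProfile a b s * sin (alphaBetaAngle a b s) / gap (alphaBetaAngle a b s) *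
          ((SignType.sign s / (a * b) * sin (alphaBetaAngle a b s) -
            alphaBetaAngle a b s * (-(s / b ^ 2) / unitRadius b s)) /
            (alphaBetaProfile a b s * gap (alphaBetaAngle a b s))) ^ 2) s :=
  hasDerivAt_deriv_profile (hasDerivAt_unitRadius hs.1)
    (hasDerivAt_abs_div (ne_zero_of_mem_slopes hs)) (hasDerivAt_unitRadius_two hb hs.1)
    (hasDerivAt_sign_div (ne_zero_of_mem_slopes hs)) hs.1 hs.2

theorem alphaBeta_first (ha : 0 < a) (hb : 0 < b) (hs : s ∈ slopes a b) :
    alphaBetaProfile a b s - s * alphaBetaDeriv a b s =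
      1 / (unitRadius b s * gap (alphaBetaAngle a b s)) := by
  have hθ : alphaBetaAngle a b s ∈ Ioo 0 (π / 2) := angle_mem hs.2
  have hg := gap_pos hθ
  have e1 : alphaBetaProfile a b s * sin (alphaBetaAngle a b s) = unitRadius b s :=
    profile_mul_sin hs.2
  have e2 : alphaBetaProfile a b s * alphaBetaAngle a b s = |s| / (a * b) :=
    profile_mul_angle hs.1 hs.2
  have e3 := (sq_lt_of_unitRadius_pos hb hs.1).1
  have e4 : (SignType.sign s : ℝ) * s = |s| := sign_mul_self s
  have hr := hs.1
  have e5 : alphaBetaProfile a b s * gap (alphaBetaAngle a b s) =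
      unitRadius b s - cos (alphaBetaAngle a b s) * (|s| / (a * b)) := by
    rw [← e1, ← e2]; unfold gap; ring
  have e6 : alphaBetaProfile a b s = (unitRadius b s - cos (alphaBetaAngle a b s) *
      (|s| / (a * b))) / gap (alphaBetaAngle a b s) := by
    rw [← e5, mul_div_cancel_right₀ _ hg.ne']
  rw [e6, alphaBetaDeriv, ← e4]
  have e7 : b ^ 2 * unitRadius b s ^ 2 = b ^ 2 - s ^ 2 := by rw [e3]; field_simp
  field_simp
  linear_combination a * e7

theorem alphaBeta_second (ha : 0 < a) (hb : 0 < b) (hs : s ∈ slopes a b) {c : ℝ}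
    (hc : s ^ 2 ≤ c ^ 2) (hcb : c ^ 2 ≤ b ^ 2) {ψ₂ : ℝ}
    (h : HasDerivAt (alphaBetaDeriv a b) ψ₂ s) :
    0 < alphaBetaProfile a b s - s * alphaBetaDeriv a b s + (c ^ 2 - s ^ 2) * ψ₂ := by
  have hθ : alphaBetaAngle a b s ∈ Ioo 0 (π / 2) := angle_mem hs.2
  have hg := gap_pos hθ
  have hsin := sin_pos_of_mem hθ
  have hF : 0 < alphaBetaProfile a b s := profile_pos hs.1 hs.2
  have hs0 := ne_zero_of_mem_slopes hs
  obtain ⟨e3, e4⟩ := sq_lt_of_unitRadius_pos hb hs.1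
  have hr := hs.1
  have hτ : (SignType.sign s / (a * b) * sin (alphaBetaAngle a b s) -
      alphaBetaAngle a b s * (-(s / b ^ 2) / unitRadius b s)) /
        (alphaBetaProfile a b s * gap (alphaBetaAngle a b s)) ≠ 0 := by
    refine div_ne_zero ?_ (by positivity)
    have hθ0 := hθ.1
    rcases lt_or_gt_of_ne hs0 with hneg | hpos
    · have hσ : ((SignType.sign s : SignType) : ℝ) = -1 := by simp [sign_neg hneg]
      rw [hσ]
      have : 0 < -s := by linarith
      have : 0 < 1 / (a * b) * sin (alphaBetaAngle a b s) +
        alphaBetaAngle a b s * ((-s) / b ^ 2 / unitRadius b s) := by positivity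
      refine ne_of_lt ?_
      ring_nf at this ⊢
      linarith
    · have hσ : ((SignType.sign s : SignType) : ℝ) = 1 := by simp [sign_pos hpos]
      rw [hσ]
      have : 0 < 1 / (a * b) * sin (alphaBetaAngle a b s) +
        alphaBetaAngle a b s * (s / b ^ 2 / unitRadius b s) := by positivity
      refine ne_of_gt ?_
      ring_nf at this ⊢
      linarith
  rw [alphaBeta_first ha hb hs, h.unique (hasDerivAt_alphaBetaDeriv hb hs)]
  generalize (SignType.sign s / (a * b) * sin (alphaBetaAngle a b s) -
      alphaBetaAngle a b s * (-(s / b ^ 2) / unitRadius b s)) /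
        (alphaBetaProfile a b s * gap (alphaBetaAngle a b s)) = τ at *
  generalize alphaBetaAngle a b s = θ at *
  generalize alphaBetaProfile a b s = F at *
  generalize unitRadius b s = r at *
  -- The part without `τ` is a nonnegative multiple of `b ^ 2 - c ^ 2`.
  have split : 1 / (r * gap θ) + (c ^ 2 - s ^ 2) *
      ((-1 / (b ^ 2 * r ^ 3) - cos θ * 0) / gap θ + F * sin θ / gap θ * τ ^ 2) =
      (b ^ 2 - c ^ 2) / (b ^ 2 * r ^ 3 * gap θ) +
        (c ^ 2 - s ^ 2) * (F * sin θ / gap θ * τ ^ 2) := by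
    have : b ^ 2 * r ^ 2 = b ^ 2 - s ^ 2 := by rw [e3]; field_simp
    field_simp
    linear_combination this
  rw [split]
  have hT : 0 < F * sin θ / gap θ * τ ^ 2 := by positivity
  rcases hcb.lt_or_eq with h1 | h1
  · have h2 : 0 < b ^ 2 - c ^ 2 := by linarith
    have h3 : 0 ≤ c ^ 2 - s ^ 2 := by linarith
    positivity
  · have h3 : 0 < c ^ 2 - s ^ 2 := by linarith
    rw [h1] at h3 ⊢
    rw [sub_self, zero_div, zero_add]
    positivity

theorem contDiffAt_alphaBetaProfile (hs : s ∈ slopes a b) :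
    ContDiffAt ℝ ∞ (alphaBetaProfile a b) s := by
  have hr : ContDiffAt ℝ ∞ (unitRadius b) s :=
    ContDiffAt.sqrt (contDiffAt_const.sub ((contDiffAt_id.div_const b).pow 2)) (sqrt_pos.1 hs.1).ne'
  have hh : ContDiffAt ℝ ∞ (fun s : ℝ => |s| / (a * b)) s :=
    ((contDiffAt_abs (n := ⊤) (ne_zero_of_mem_slopes hs)).div_const (a * b) :)
  exact hr.div (contDiff_sin.contDiffAt.comp s ((contDiffAt_angle hs.2).comp s
    (hh.div hr hs.1.ne'))) (sin_pos_of_mem (angle_mem hs.2)).ne'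

theorem betaStar_inner (b : ℝ) (y : E3) : innerSL ℝ (betaStar b) y = b * y 2 := by
  simp [betaStar, PiLp.inner_apply, Fin.sum_univ_three, mul_comm]

theorem norm_betaStar (hb : 0 < b) : ‖innerSL ℝ (betaStar b)‖ = b := by
  rw [innerSL_apply_norm, ← sqrt_sq (norm_nonneg (betaStar b)), EuclideanSpace.norm_sq_eq]
  simp [betaStar, Fin.sum_univ_three, sqrt_sq hb.le]

theorem unitRadius_slope (hb : 0 < b) (hy : y ≠ 0) :
    unitRadius b (b * y 2 / ‖y‖) = radius y / ‖y‖ ∧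
      |b * y 2 / ‖y‖| / (a * b) = height a y / ‖y‖ := by
  have hn : 0 < ‖y‖ := norm_pos_iff.2 hy
  have hn2 : ‖y‖ ^ 2 = y 0 ^ 2 + y 1 ^ 2 + y 2 ^ 2 := by
    simp [EuclideanSpace.norm_sq_eq, Fin.sum_univ_three]
  constructor
  · have : 1 - (b * y 2 / ‖y‖ / b) ^ 2 = (y 0 ^ 2 + y 1 ^ 2) / ‖y‖ ^ 2 := by
      field_simp
      rw [hn2]; ring
    rw [unitRadius, this, sqrt_div' _ (by positivity), sqrt_sq hn.le, radius]
  · rw [abs_div, abs_mul, abs_of_pos hb, abs_of_pos hn, height]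
    field_simp

theorem isAlphaBeta (ha : 0 < a) (hb : 0 < b) :
    (helicoidMetric a ha).IsAlphaBeta (innerSL ℝ (betaStar b)) := by
  have hD : Icc (-b) b \ (Icc (-b) b \ slopes a b) = slopes a b := by
    rw [sdiff_sdiff_cancel_left (slopes_subset hb)]
  have hdom : cone a = {y | y ≠ 0 ∧ b * y 2 / ‖y‖ ∈ slopes a b} := by
    ext y
    by_cases hy : y = 0
    · simp [hy, cone, radius]
    · have hn : 0 < ‖y‖ := norm_pos_iff.2 hy
      obtain ⟨h1, h2⟩ := unitRadius_slope (a := a) hb hy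
      simp only [cone, slopes, mem_ofPred_eq, h1, h2, ne_eq, hy, not_false_eq_true, true_and,
        div_pos_iff_of_pos_right hn, div_div_div_cancel_right₀ hn.ne']
  have hO := isOpen_slopes a b
  have hderiv : EqOn (derivWithin (alphaBetaProfile a b) (slopes a b)) (alphaBetaDeriv a b)
      (slopes a b) := fun s hs => by
    rw [derivWithin_of_isOpen hO hs, (hasDerivAt_alphaBetaProfile hs).deriv]
  refine ⟨b, Icc (-b) b \ slopes a b, alphaBetaProfile a b, (norm_betaStar hb).le,
    isClosed_Icc.sdiff hO, sdiff_subset, ?_⟩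
  rw [hD]
  refine ⟨fun s hs => (contDiffAt_alphaBetaProfile hs).contDiffWithinAt,
    fun s hs => profile_pos hs.1 hs.2, ?_, ?_, ?_⟩
  · rintro c ⟨hc0, hcb⟩ s ⟨hsc, hsC⟩
    have hs : s ∈ slopes a b := by
      by_contra hns
      exact hsC ⟨⟨by linarith [hsc.1], by linarith [hsc.2]⟩, hns⟩
    have hθ : alphaBetaAngle a b s ∈ Ioo 0 (π / 2) := angle_mem hs.2
    have h2 : HasDerivAt (alphaBetaDeriv a b)
        (iteratedDerivWithin 2 (alphaBetaProfile a b) (slopes a b) s) s := by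
      have e := hasDerivAt_alphaBetaDeriv hb hs
      rw [iteratedDerivWithin_succ, derivWithin_of_isOpen hO hs]
      have hev : iteratedDerivWithin 1 (alphaBetaProfile a b) (slopes a b) =ᶠ[𝓝 s]
          alphaBetaDeriv a b := by
        filter_upwards [hO.mem_nhds hs] with t ht
        rw [iteratedDerivWithin_one, hderiv ht]
      rw [hev.deriv_eq, e.deriv]
      exact e
    rw [hderiv hs]
    refine ⟨?_, alphaBeta_second ha hb hs (sq_le_sq.2 ?_) (by gcongr) h2⟩
    · rw [alphaBeta_first ha hb hs]
      exact one_div_pos.2 (mul_pos hs.1 (gap_pos hθ))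
    · rw [abs_of_nonneg hc0]
      exact abs_le.2 hsc
  · simp only [betaStar_inner]
    exact hdom
  · intro y hy
    have hy0 : y ≠ 0 := (hdom.subset hy).1
    have hn : 0 < ‖y‖ := norm_pos_iff.2 hy0
    obtain ⟨h1, h2⟩ := unitRadius_slope (a := a) hb hy0
    rw [betaStar_inner, alphaBetaProfile, h1, h2, ← profile_smul hn.ne', mul_div_cancel₀ _ hn.ne',
      mul_div_cancel₀ _ hn.ne']
    rfl

/-! ### Unit normal fields of the helicoid -/

variable {a b : ℝ} {M : ConicMinkowskiMetric E3} {p : ℝ × ℝ} {y : E3}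

theorem mem_dom_iff (ha : 0 < a) (hb : 0 < b)
    (hM : M.HasDual (helicoidDualDom a b) (helicoidDualMetric a b)) : y ∈ M.dom ↔ y ∈ cone a :=
  ⟨fun h => (hM.subset_of_hasDual (hasDual ha hb)
      (fun _ => differentiableAt_helicoidDualMetric ha hb) h).1,
    fun h => ((hasDual ha hb).subset_of_hasDual hM
      (fun _ => differentiableAt_helicoidDualMetric ha hb) h).1⟩

theorem F_eq (ha : 0 < a) (hb : 0 < b)
    (hM : M.HasDual (helicoidDualDom a b) (helicoidDualMetric a b)) (hy : y ∈ cone a) :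
    M.F y = metric a y :=
  ((hasDual ha hb).subset_of_hasDual hM
    (fun _ => differentiableAt_helicoidDualMetric ha hb) hy).2.1

theorem legendre_eq (ha : 0 < a) (hb : 0 < b)
    (hM : M.HasDual (helicoidDualDom a b) (helicoidDualMetric a b)) (hy : y ∈ cone a) :
    M.legendre y = (helicoidMetric a ha).legendre y :=
  ((hasDual ha hb).subset_of_hasDual hM
    (fun _ => differentiableAt_helicoidDualMetric ha hb) hy).2.2

/-- The direction of the ruling of the helicoid. -/
noncomputable def ruling (p : ℝ × ℝ) : E3 := !₂[cos p.2, sin p.2, 0]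

/-- The velocity of the helical motion. -/
noncomputable def helical (a : ℝ) (p : ℝ × ℝ) : E3 := !₂[-(p.1 * sin p.2), p.1 * cos p.2, a]

/-- A unit normal field of the helicoid; the other one is its negative. -/
noncomputable def unitNormal (a : ℝ) (p : ℝ × ℝ) : E3 :=
  !₂[√(1 - p.1 ^ 2) * sin p.2, -(√(1 - p.1 ^ 2) * cos p.2), -(a * arccos p.1)]

/-- The conormal of the helicoid, normalized to have horizontal part of length `1`. -/
noncomputable def conormal (a : ℝ) (p : ℝ × ℝ) (v : E3) : ℝ :=
  sin p.2 * v 0 - cos p.2 * v 1 + p.1 / a * v 2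

/-- The differential of the helicoid. -/
noncomputable def helicoidDeriv (a : ℝ) (p : ℝ × ℝ) : ℝ × ℝ →L[ℝ] E3 :=
  (ContinuousLinearMap.fst ℝ ℝ ℝ).smulRight (ruling p) +
    (ContinuousLinearMap.snd ℝ ℝ ℝ).smulRight (helical a p)

/-- The differential of `unitNormal`. -/
noncomputable def unitNormalDeriv (a : ℝ) (p : ℝ × ℝ) : ℝ × ℝ →L[ℝ] E3 :=
  (ContinuousLinearMap.fst ℝ ℝ ℝ).smulRight ((√(1 - p.1 ^ 2))⁻¹ • helical a p) +
    (ContinuousLinearMap.snd ℝ ℝ ℝ).smulRight (√(1 - p.1 ^ 2) • ruling p)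

theorem helicoidDeriv_apply (a : ℝ) (p X : ℝ × ℝ) :
    helicoidDeriv a p X = X.1 • ruling p + X.2 • helical a p := by
  simp [helicoidDeriv]

theorem unitNormalDeriv_apply (a : ℝ) (p X : ℝ × ℝ) : unitNormalDeriv a p X =
    (X.1 / √(1 - p.1 ^ 2)) • helical a p + (X.2 * √(1 - p.1 ^ 2)) • ruling p := by
  simp [unitNormalDeriv, smul_smul, div_eq_mul_inv]

theorem hasFDerivAt_helicoid (a : ℝ) (p : ℝ × ℝ) :
    HasFDerivAt (helicoid a) (helicoidDeriv a p) p := by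
  have h1 : HasFDerivAt (fun p : ℝ × ℝ => p.1) (ContinuousLinearMap.fst ℝ ℝ ℝ) p := hasFDerivAt_fst
  have h2 : HasFDerivAt (fun p : ℝ × ℝ => p.2) (ContinuousLinearMap.snd ℝ ℝ ℝ) p := hasFDerivAt_snd
  rw [← hasFDerivWithinAt_univ, hasFDerivWithinAt_euclidean]
  intro i
  rw [hasFDerivWithinAt_univ]
  fin_cases i
  · refine (h1.mul h2.cos).congr_fderiv ?_
    ext <;> simp [helicoidDeriv, ruling, helical]
  · refine (h1.mul h2.sin).congr_fderiv ?_
    ext <;> simp [helicoidDeriv, ruling, helical]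
  · refine (h2.const_mul a).congr_fderiv ?_
    ext <;> simp [helicoidDeriv, ruling, helical]

theorem one_sub_sq_pos (hp : p ∈ helicoidParams) : 0 < 1 - p.1 ^ 2 := by
  obtain ⟨h0, h1⟩ := hp.1
  nlinarith

theorem hasFDerivAt_unitNormal (hp : p ∈ helicoidParams) :
    HasFDerivAt (unitNormal a) (unitNormalDeriv a p) p := by
  have h1 : HasFDerivAt (fun p : ℝ × ℝ => p.1) (ContinuousLinearMap.fst ℝ ℝ ℝ) p := hasFDerivAt_fst
  have h2 : HasFDerivAt (fun p : ℝ × ℝ => p.2) (ContinuousLinearMap.snd ℝ ℝ ℝ) p := hasFDerivAt_snd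
  have hpos := one_sub_sq_pos hp
  have hs : 0 < √(1 - p.1 ^ 2) := sqrt_pos.2 hpos
  have h3 := ((h1.pow 2).const_sub 1).sqrt hpos.ne'
  have h4 := (hasDerivAt_arccos (x := p.1) (by linarith [hp.1.1]) hp.1.2.ne).comp_hasFDerivAt p h1
  rw [← hasFDerivWithinAt_univ, hasFDerivWithinAt_euclidean]
  intro i
  rw [hasFDerivWithinAt_univ]
  fin_cases i
  · refine (h3.mul h2.sin).congr_fderiv ?_
    ext <;> simp [unitNormalDeriv, ruling, helical]
    field_simp
  · refine (h3.mul h2.cos).neg.congr_fderiv ?_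
    ext <;> simp [unitNormalDeriv, ruling, helical]
    field_simp
  · refine (h4.const_mul a).neg.congr_fderiv ?_
    ext <;> simp [unitNormalDeriv, ruling, helical]
    field_simp

theorem contDiff_helicoid (a : ℝ) : ContDiff ℝ ∞ (helicoid a) := by
  rw [contDiff_euclidean]
  intro i
  fin_cases i
  · exact contDiff_fst.mul (contDiff_cos.comp contDiff_snd)
  · exact contDiff_fst.mul (contDiff_sin.comp contDiff_snd)
  · exact contDiff_const.mul contDiff_snd

theorem contDiffAt_unitNormal (hp : p ∈ helicoidParams) : ContDiffAt ℝ ∞ (unitNormal a) p := by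
  have h1 : ContDiffAt ℝ ∞ (fun p : ℝ × ℝ => √(1 - p.1 ^ 2)) p :=
    ContDiffAt.sqrt (contDiffAt_const.sub (contDiffAt_fst.pow 2)) (one_sub_sq_pos hp).ne'
  have h2 : ContDiffAt ℝ ∞ (fun p : ℝ × ℝ => arccos p.1) p :=
    (contDiffAt_arccos (x := p.1) (by linarith [hp.1.1]) hp.1.2.ne).comp p contDiffAt_fst
  rw [contDiffAt_euclidean]
  intro i
  fin_cases i
  · exact h1.mul (contDiff_sin.comp contDiff_snd).contDiffAt
  · exact (h1.mul (contDiff_cos.comp contDiff_snd).contDiffAt).neg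
  · exact (contDiffAt_const.mul h2).neg

theorem isOpen_helicoidParams : IsOpen helicoidParams := isOpen_Ioo.prod isOpen_univ

theorem arccos_mem_of_params (hp : p ∈ helicoidParams) : arccos p.1 ∈ Ioo 0 (π / 2) :=
  ⟨arccos_pos.2 hp.1.2, arccos_lt_pi_div_two.2 hp.1.1⟩

theorem cos_arccos_of_params (hp : p ∈ helicoidParams) : cos (arccos p.1) = p.1 :=
  cos_arccos (by linarith [hp.1.1]) hp.1.2.le

theorem conormal_ruling (a : ℝ) (p : ℝ × ℝ) : conormal a p (ruling p) = 0 := by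
  simp [conormal, ruling]; ring

theorem conormal_helical (ha : 0 < a) (p : ℝ × ℝ) : conormal a p (helical a p) = 0 := by
  simp [conormal, helical]
  field_simp
  linear_combination -p.1 * sin_sq_add_cos_sq p.2

theorem conormal_unitNormal (ha : 0 < a) (hp : p ∈ helicoidParams) :
    conormal a p (unitNormal a p) = gap (arccos p.1) := by
  rw [gap, sin_arccos, cos_arccos_of_params hp]
  simp [conormal, unitNormal]
  field_simp
  linear_combination √(1 - p.1 ^ 2) * sin_sq_add_cos_sq p.2

theorem ruling_add_helical_eq_zero (ha : 0 < a) {x z : ℝ}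
    (h : x • ruling p + z • helical a p = 0) : x = 0 ∧ z = 0 := by
  have h0 := congrArg (fun w : E3 => w 0) h
  have h1 := congrArg (fun w : E3 => w 1) h
  have h2 := congrArg (fun w : E3 => w 2) h
  simp [ruling, helical, ha.ne'] at h0 h1 h2
  subst h2
  simp only [zero_mul, neg_zero, add_zero] at h0 h1
  refine ⟨?_, rfl⟩
  linear_combination cos p.2 * h0 + sin p.2 * h1 - x * sin_sq_add_cos_sq p.2

theorem helicoidDeriv_injective (ha : 0 < a) (p : ℝ × ℝ) :
    Function.Injective (helicoidDeriv a p) := by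
  rw [injective_iff_map_eq_zero]
  intro X hX
  rw [helicoidDeriv_apply] at hX
  obtain ⟨h1, h2⟩ := ruling_add_helical_eq_zero ha hX
  exact Prod.ext h1 h2

/-- A covector that vanishes on the tangent plane is a multiple of the conormal. -/
theorem eq_smul_conormal (ha : 0 < a) {ξ : StrongDual ℝ E3} (h1 : ξ (ruling p) = 0)
    (h2 : ξ (helical a p) = 0) :
    ∃ k : ℝ, ∀ v, ξ v = k * conormal a p v := by
  rw [dual_apply] at h1 h2
  simp [ruling, helical] at h1 h2
  refine ⟨sin p.2 * coord 0 ξ - cos p.2 * coord 1 ξ, fun v => ?_⟩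
  rw [dual_apply, conormal]
  have hsc := sin_sq_add_cos_sq p.2
  field_simp
  linear_combination v 2 * h2 + (a * v 0 * cos p.2 + a * v 1 * sin p.2) * h1 -
    (a * v 0 * coord 0 ξ + a * v 1 * coord 1 ξ) * hsc

theorem unitNormal_mem (ha : 0 < a) (hp : p ∈ helicoidParams) {σ : ℝ} (hσ : σ = 1 ∨ σ = -1) :
    σ • unitNormal a p ∈ cone a ∧ metric a (σ • unitNormal a p) = 1 ∧
      coneAngle a (σ • unitNormal a p) = arccos p.1 := by
  have hs : 0 < √(1 - p.1 ^ 2) := sqrt_pos.2 (one_sub_sq_pos hp)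
  have hθ := arccos_mem_of_params hp
  have hσ2 : σ ^ 2 = 1 := by rcases hσ with h | h <;> simp [h]
  have hσa : |σ| = 1 := by rcases hσ with h | h <;> simp [h]
  refine mem_cone_of_polar one_pos hθ ?_ ?_
  · have : (σ • unitNormal a p) 0 ^ 2 + (σ • unitNormal a p) 1 ^ 2 = √(1 - p.1 ^ 2) ^ 2 := by
      simp [unitNormal]
      linear_combination √(1 - p.1 ^ 2) ^ 2 * hσ2 +
        σ ^ 2 * √(1 - p.1 ^ 2) ^ 2 * sin_sq_add_cos_sq p.2
    rw [radius, this, sqrt_sq hs.le, sin_arccos, one_mul]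
  · simp [height, unitNormal, abs_mul, hσa, abs_of_pos ha, abs_of_pos hθ.1, ha.ne']

theorem legendre_unitNormal (ha : 0 < a) (hb : 0 < b)
    (hM : M.HasDual (helicoidDualDom a b) (helicoidDualMetric a b)) (hp : p ∈ helicoidParams)
    (v : E3) : M.legendre (unitNormal a p) v = conormal a p v / gap (arccos p.1) := by
  obtain ⟨hmem, hF, hθ⟩ := unitNormal_mem ha hp (Or.inl rfl)
  rw [one_smul] at hmem hF hθ
  have hs : 0 < √(1 - p.1 ^ 2) := sqrt_pos.2 (one_sub_sq_pos hp)
  have hr : radius (unitNormal a p) = √(1 - p.1 ^ 2) := by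
    rw [← metric_mul_sin hmem, hF, hθ, one_mul, sin_arccos]
  have h2 : unitNormal a p 2 < 0 := by
    have := mul_pos ha (arccos_mem_of_params hp).1
    change -(a * arccos p.1) < 0
    linarith
  have hg := gap_pos (arccos_mem_of_params hp)
  rw [legendre_eq ha hb hM hmem, legendre_apply ha hmem, hF, hθ, hr, cos_arccos_of_params hp,
    sign_neg h2, conormal]
  simp [unitNormal]
  field_simp
  ring

/-- A unit vector whose Legendre transform vanishes on the tangent plane is `± unitNormal`. -/
theorem eq_unitNormal (ha : 0 < a) (hb : 0 < b)
    (hM : M.HasDual (helicoidDualDom a b) (helicoidDualMetric a b)) (hp : p ∈ helicoidParams)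
    (hy : y ∈ M.dom) (hF : M.F y = 1) (h1 : M.legendre y (ruling p) = 0)
    (h2 : M.legendre y (helical a p) = 0) : ∃ σ : ℝ, (σ = 1 ∨ σ = -1) ∧ y = σ • unitNormal a p := by
  rw [mem_dom_iff ha hb hM] at hy
  rw [F_eq ha hb hM hy] at hF
  rw [legendre_eq ha hb hM hy, legendre_apply ha hy, hF] at h1 h2
  have hθ := coneAngle_mem hy
  have hg := gap_pos hθ
  have hr := hy.1
  have hr2 := radius_sq y
  have hsc := sin_sq_add_cos_sq p.2
  have hsign := abs_sign_eq_one (third_ne_zero hy)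
  have hrs := metric_mul_sin hy
  have hhs := metric_mul_angle hy
  have hy2 := sign_mul_abs (y 2)
  rw [hF, one_mul] at hrs hhs
  replace h1 := (mul_eq_zero.1 h1).resolve_left (by positivity)
  replace h2 := (mul_eq_zero.1 h2).resolve_left (by positivity)
  simp [ruling] at h1
  simp [helical] at h2
  generalize ((SignType.sign (y 2) : SignType) : ℝ) = τ at *
  have e1 : y 0 * cos p.2 + y 1 * sin p.2 = 0 := h1.resolve_right hr.ne'
  set k : ℝ := (sin p.2 * y 0 - cos p.2 * y 1) / radius y with hk
  have hkr : k * radius y = sin p.2 * y 0 - cos p.2 * y 1 := div_mul_cancel₀ _ hr.ne'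
  have y0 : y 0 = radius y * k * sin p.2 := by
    linear_combination -sin p.2 * hkr + cos p.2 * e1 - y 0 * hsc
  have y1 : y 1 = -(radius y * k * cos p.2) := by
    linear_combination cos p.2 * hkr + sin p.2 * e1 - y 1 * hsc
  have hk2 : k ^ 2 = 1 := by
    have : radius y ^ 2 * (k ^ 2 - 1) = 0 := by
      rw [y0, y1] at hr2
      linear_combination -hr2 - radius y ^ 2 * k ^ 2 * hsc
    have := (mul_eq_zero.1 this).resolve_left (by positivity)
    linarith
  have e2 : cos (coneAngle a y) * τ = -(k * p.1) := by
    have : cos (coneAngle a y) * (τ * a / a) = cos (coneAngle a y) * τ := by field_simp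
    rw [this] at h2
    rw [hk]
    field_simp at h2 ⊢
    linear_combination -h2
  have hkabs : |k| = 1 := by
    rw [← abs_one]; exact (sq_eq_sq_iff_abs_eq_abs _ _).1 (by rw [hk2, one_pow])
  have e3 : cos (coneAngle a y) = p.1 := by
    have := congrArg abs e2
    rwa [abs_mul, hsign, abs_neg, abs_mul, hkabs, abs_of_pos (cos_pos_of_mem hθ),
      abs_of_pos hp.1.1, mul_one, one_mul] at this
  have e4 : coneAngle a y = arccos p.1 := by
    rw [← e3, arccos_cos hθ.1.le (by linarith [hθ.2, pi_pos])]
  have e5 : τ = -k := by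
    rw [e3] at e2
    exact mul_left_cancel₀ hp.1.1.ne' (by linear_combination e2)
  have e6 : radius y = √(1 - p.1 ^ 2) := by rw [← hrs, e4, sin_arccos]
  have e7 : |y 2| = a * arccos p.1 := by
    rw [← e4, hhs, height]; field_simp
  refine ⟨k, ?_, ?_⟩
  · exact sq_eq_one_iff.1 hk2
  · ext i
    fin_cases i
    · change y 0 = k * (√(1 - p.1 ^ 2) * sin p.2)
      rw [← e6]; linear_combination y0
    · change y 1 = k * -(√(1 - p.1 ^ 2) * cos p.2)
      rw [← e6]; linear_combination y1
    · change y 2 = k * -(a * arccos p.1)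
      rw [← e7, ← hy2, e5, abs_mul, abs_neg, hkabs, abs_abs]; ring

/-! ### The shape operator of the helicoid -/

variable {a b : ℝ} {M : ConicMinkowskiMetric E3} {p : ℝ × ℝ} {W : Set (ℝ × ℝ)} {n : ℝ × ℝ → E3}

theorem legendre_unitNormal_tangent (ha : 0 < a) (hb : 0 < b)
    (hM : M.HasDual (helicoidDualDom a b) (helicoidDualMetric a b)) (hp : p ∈ helicoidParams)
    (X : ℝ × ℝ) : M.legendre (unitNormal a p) (helicoidDeriv a p X) = 0 := by
  rw [helicoidDeriv_apply, map_add, map_smul, map_smul, legendre_unitNormal ha hb hM hp,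
    legendre_unitNormal ha hb hM hp, conormal_ruling, conormal_helical ha]
  simp

theorem isUnitNormalOn_unitNormal (ha : 0 < a) (hb : 0 < b)
    (hM : M.HasDual (helicoidDualDom a b) (helicoidDualMetric a b)) :
    M.IsUnitNormalOn (helicoid a) (unitNormal a) helicoidParams where
  smooth _ hp := (contDiffAt_unitNormal hp).contDiffWithinAt
  mem_dom p hp := by
    have := unitNormal_mem ha hp (Or.inl rfl)
    rw [one_smul] at this
    exact (mem_dom_iff ha hb hM).2 this.1
  unit p hp := by
    have := unitNormal_mem ha hp (Or.inl rfl)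
    rw [one_smul] at this
    rw [F_eq ha hb hM this.1, this.2.1]
  conormal p hp X := by
    rw [(hasFDerivAt_helicoid a p).fderiv, legendre_unitNormal_tangent ha hb hM hp]

theorem isConicHypersurface (ha : 0 < a) (hb : 0 < b)
    (hM : M.HasDual (helicoidDualDom a b) (helicoidDualMetric a b)) :
    M.IsConicHypersurface (helicoid a) helicoidParams where
  isOpen := isOpen_helicoidParams
  codim := by simp
  smooth := (contDiff_helicoid a).contDiffOn
  immersion p _ := by
    rw [(hasFDerivAt_helicoid a p).fderiv]
    exact helicoidDeriv_injective ha p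
  exists_normal := ⟨unitNormal a, isUnitNormalOn_unitNormal ha hb hM⟩

/-- A unit normal field is near each point one of the two standard ones: the sign of its third
component tells which. -/
theorem exists_sign_eventually (ha : 0 < a) (hb : 0 < b)
    (hM : M.HasDual (helicoidDualDom a b) (helicoidDualMetric a b)) (hW : IsOpen W)
    (hWs : W ⊆ helicoidParams) (hn : M.IsUnitNormalOn (helicoid a) n W) (hp : p ∈ W) :
    ∃ σ : ℝ, (σ = 1 ∨ σ = -1) ∧ n =ᶠ[𝓝 p] fun q => σ • unitNormal a q := by
  have hex (q : ℝ × ℝ) (hq : q ∈ W) :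
      ∃ σ : ℝ, (σ = 1 ∨ σ = -1) ∧ n q = σ • unitNormal a q := by
    have hc := hn.conormal q hq
    rw [(hasFDerivAt_helicoid a q).fderiv] at hc
    refine eq_unitNormal ha hb hM (hWs hq) (hn.mem_dom q hq) (hn.unit q hq) ?_ ?_
    · simpa [helicoidDeriv_apply] using hc (1, 0)
    · simpa [helicoidDeriv_apply] using hc (0, 1)
  have hthird (q : ℝ × ℝ) (hq : q ∈ W) : unitNormal a q 2 < 0 := by
    have := mul_pos ha (arccos_mem_of_params (hWs hq)).1
    change -(a * arccos q.1) < 0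
    linarith
  obtain ⟨σ, hσ, hnp⟩ := hex p hp
  refine ⟨σ, hσ, ?_⟩
  have hcont : ContinuousAt (fun q => σ * n q 2) p := by
    have h1 : ContinuousAt n p := (hn.smooth.contDiffAt (hW.mem_nhds hp)).continuousAt
    have h2 : Continuous fun w : E3 => σ * w 2 := by fun_prop
    exact h2.continuousAt.comp h1
  have hσ2 : σ * σ = 1 := by rcases hσ with h | h <;> simp [h]
  have hlt : σ * n p 2 < 0 := by
    have : σ * n p 2 = (σ * σ) * unitNormal a p 2 := by rw [hnp]; simp [mul_assoc]
    rw [this, hσ2, one_mul]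
    exact hthird p hp
  filter_upwards [hcont.eventually_mem (isOpen_Iio.mem_nhds hlt), hW.mem_nhds hp] with q hq hqW
  obtain ⟨τ, hτ, hnq⟩ := hex q hqW
  have h3 := hthird q hqW
  have h4 : σ * (τ * unitNormal a q 2) < 0 := by
    have : n q 2 = τ * unitNormal a q 2 := by rw [hnq]; simp
    rw [← this]; exact hq
  have : τ = σ := by
    rcases hσ with rfl | rfl <;> rcases hτ with rfl | rfl <;> first | rfl | (exfalso; linarith)
  rw [hnq, this]

/-- The shape operator of the helicoid with respect to `unitNormal`, in the parameters `(u, v)`. -/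
noncomputable def shape (p : ℝ × ℝ) : ℝ × ℝ →ₗ[ℝ] ℝ × ℝ where
  toFun X := (-(X.2 * √(1 - p.1 ^ 2)), -(X.1 / √(1 - p.1 ^ 2)))
  map_add' X Y := by ext <;> simp <;> ring
  map_smul' c X := by ext <;> simp <;> ring

theorem shape_apply (p X : ℝ × ℝ) :
    shape p X = (-(X.2 * √(1 - p.1 ^ 2)), -(X.1 / √(1 - p.1 ^ 2))) := rfl

theorem unitNormalDeriv_eq_shape (a : ℝ) (p X : ℝ × ℝ) :
    unitNormalDeriv a p X = -helicoidDeriv a p (shape p X) := by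
  rw [unitNormalDeriv_apply, helicoidDeriv_apply, shape_apply]
  module

theorem exists_sign_isShapeOperator_iff (ha : 0 < a) (hb : 0 < b)
    (hM : M.HasDual (helicoidDualDom a b) (helicoidDualMetric a b)) (hW : IsOpen W)
    (hWs : W ⊆ helicoidParams) (hn : M.IsUnitNormalOn (helicoid a) n W) (hp : p ∈ W) :
    ∃ σ : ℝ, (σ = 1 ∨ σ = -1) ∧
      ∀ S, M.IsShapeOperator (helicoid a) n p S ↔ S = σ • shape p := by
  obtain ⟨σ, hσ, hev⟩ := exists_sign_eventually ha hb hM hW hWs hn hp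
  refine ⟨σ, hσ, fun S => ?_⟩
  have hdn : fderiv ℝ n p = σ • unitNormalDeriv a p := by
    rw [hev.fderiv_eq]
    exact ((hasFDerivAt_unitNormal (hWs hp)).const_smul σ).fderiv
  have hdiff (X : ℝ × ℝ) : fderiv ℝ (helicoid a) p (S X) + fderiv ℝ n p X =
      helicoidDeriv a p (S X - (σ • shape p) X) := by
    rw [hdn, (hasFDerivAt_helicoid a p).fderiv, smul_apply,
      unitNormalDeriv_eq_shape, map_sub, LinearMap.smul_apply, map_smul]
    module
  unfold ConicMinkowskiMetric.IsShapeOperator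
  simp only [hdiff]
  rw [(hasFDerivAt_helicoid a p).fderiv]
  constructor
  · intro h
    refine LinearMap.ext fun X => ?_
    by_contra hne
    have hZ : helicoidDeriv a p (S X - (σ • shape p) X) ≠ 0 := by
      intro h0
      rw [← map_zero (helicoidDeriv a p)] at h0
      exact hne (sub_eq_zero.1 (helicoidDeriv_injective ha p h0))
    have := M.posDef (n p) (hn.mem_dom p hp) _ hZ
    exact this.ne' (h X _)
  · rintro rfl X Y
    simp [ConicMinkowskiMetric.fundamentalTensor]

theorem trace_shape (p : ℝ × ℝ) : LinearMap.trace ℝ (ℝ × ℝ) (shape p) = 0 := by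
  rw [LinearMap.trace_eq_matrix_trace ℝ (Module.Basis.finTwoProd ℝ)]
  simp [Matrix.trace, LinearMap.toMatrix_apply, shape_apply]

theorem shape_shape (hp : p ∈ helicoidParams) (X : ℝ × ℝ) : shape p (shape p X) = X := by
  have hs : 0 < √(1 - p.1 ^ 2) := sqrt_pos.2 (one_sub_sq_pos hp)
  simp only [shape_apply]
  ext
  · simp; field_simp
  · simp; field_simp

/-- The shape operator is an involution interchanging the `u` and `v` directions, so its eigenvalues
are `1` and `-1`. -/
theorem hasEigenvalue_shape_iff (hp : p ∈ helicoidParams) {σ : ℝ} (hσ : σ = 1 ∨ σ = -1) (k : ℝ) :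
    Module.End.HasEigenvalue (σ • shape p) k ↔ k = 1 ∨ k = -1 := by
  have hs : 0 < √(1 - p.1 ^ 2) := sqrt_pos.2 (one_sub_sq_pos hp)
  have hσ2 : σ * σ = 1 := by rcases hσ with h | h <;> simp [h]
  constructor
  · intro h
    obtain ⟨X, hX⟩ := h.exists_hasEigenvector
    have h1 := hX.apply_eq_smul
    have h2 : (σ • shape p) ((σ • shape p) X) = X := by
      simp [shape_shape hp, smul_smul, hσ2]
    rw [h1, map_smul, h1, smul_smul] at h2
    have h3 : (k * k - 1) • X = 0 := by rw [sub_smul, h2, one_smul, sub_self]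
    have h4 := (smul_eq_zero.1 h3).resolve_right hX.2
    exact sq_eq_one_iff.1 (by linarith)
  · intro hk
    have hk2 : k * k = 1 := by rcases hk with h | h <;> simp [h]
    refine Module.End.hasEigenvalue_of_hasEigenvector
      (x := (√(1 - p.1 ^ 2), -(σ * k))) ⟨?_, ?_⟩
    · rw [Module.End.mem_eigenspace_iff, LinearMap.smul_apply, shape_apply]
      ext
      · simp
        linear_combination √(1 - p.1 ^ 2) * k * hσ2
      · simp [hs.ne']
        linear_combination -σ * hk2
    · intro h
      exact hs.ne' (congrArg Prod.fst h)

theorem isMinimal (ha : 0 < a) (hb : 0 < b)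
    (hM : M.HasDual (helicoidDualDom a b) (helicoidDualMetric a b)) :
    M.IsMinimal (helicoid a) helicoidParams := by
  intro W n hW hWs hn p hp
  obtain ⟨σ, -, h⟩ := exists_sign_isShapeOperator_iff ha hb hM hW hWs hn hp
  exact ⟨σ • shape p, (h _).2 rfl, by rw [map_smul, trace_shape, smul_zero]⟩

theorem isPrincipalCurvature_iff (ha : 0 < a) (hb : 0 < b)
    (hM : M.HasDual (helicoidDualDom a b) (helicoidDualMetric a b)) (hW : IsOpen W)
    (hWs : W ⊆ helicoidParams) (hn : M.IsUnitNormalOn (helicoid a) n W) (hp : p ∈ W) (k : ℝ) :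
    M.IsPrincipalCurvature (helicoid a) n p k ↔ k = 1 ∨ k = -1 := by
  obtain ⟨σ, hσ, h⟩ := exists_sign_isShapeOperator_iff ha hb hM hW hWs hn hp
  rw [← hasEigenvalue_shape_iff (hWs hp) hσ k]
  constructor
  · rintro ⟨S, hS, hk⟩
    exact (h S).1 hS ▸ hk
  · exact fun hk => ⟨_, (h _).2 rfl, hk⟩

/-! ### Parallel surfaces of the helicoid -/

variable {a b : ℝ} {M : ConicMinkowskiMetric E3}

/-- The parallel surfaces of the helicoid: `(p, t)` is mapped to the point at distance `t` from the
point `p` in the direction of the unit normal. -/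
noncomputable def parallel (a : ℝ) (q : (ℝ × ℝ) × ℝ) : E3 :=
  helicoid a q.1 + q.2 • unitNormal a q.1

/-- The range of the parameters `(p, t)`: the focal points are at `t = ± 1`. -/
def parallelParams : Set ((ℝ × ℝ) × ℝ) := helicoidParams ×ˢ Ioo (-1) 1

/-- The differential of `parallel`. -/
noncomputable def parallelDeriv (a : ℝ) (q : (ℝ × ℝ) × ℝ) : (ℝ × ℝ) × ℝ →L[ℝ] E3 :=
  (helicoidDeriv a q.1 + q.2 • unitNormalDeriv a q.1).comp (ContinuousLinearMap.fst ℝ (ℝ × ℝ) ℝ) +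
    (ContinuousLinearMap.snd ℝ (ℝ × ℝ) ℝ).smulRight (unitNormal a q.1)

variable {q : (ℝ × ℝ) × ℝ}

theorem parallelDeriv_apply (a : ℝ) (q X : (ℝ × ℝ) × ℝ) : parallelDeriv a q X =
    (X.1.1 + q.2 * (X.1.2 * √(1 - q.1.1 ^ 2))) • ruling q.1 +
      (X.1.2 + q.2 * (X.1.1 / √(1 - q.1.1 ^ 2))) • helical a q.1 + X.2 • unitNormal a q.1 := by
  simp only [parallelDeriv, add_apply, ContinuousLinearMap.comp_apply,
    ContinuousLinearMap.coe_fst', ContinuousLinearMap.coe_snd', smul_apply,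
    ContinuousLinearMap.smulRight_apply, helicoidDeriv_apply, unitNormalDeriv_apply]
  module

theorem isOpen_parallelParams : IsOpen parallelParams := isOpen_helicoidParams.prod isOpen_Ioo

theorem contDiffAt_parallel (hq : q ∈ parallelParams) : ContDiffAt ℝ ∞ (parallel a) q :=
  ((contDiff_helicoid a).contDiffAt.comp q contDiffAt_fst).add
    (contDiffAt_snd.smul ((contDiffAt_unitNormal hq.1).comp q contDiffAt_fst))

theorem hasFDerivAt_parallel (hq : q ∈ parallelParams) :
    HasFDerivAt (parallel a) (parallelDeriv a q) q := by
  have h1 : HasFDerivAt (fun q : (ℝ × ℝ) × ℝ => q.1) (ContinuousLinearMap.fst ℝ (ℝ × ℝ) ℝ) q :=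
    hasFDerivAt_fst
  have h2 : HasFDerivAt (fun q : (ℝ × ℝ) × ℝ => q.2) (ContinuousLinearMap.snd ℝ (ℝ × ℝ) ℝ) q :=
    hasFDerivAt_snd
  have h3 := ((hasFDerivAt_helicoid a q.1).comp q h1).add
    (h2.smul ((hasFDerivAt_unitNormal (a := a) hq.1).comp q h1))
  refine h3.congr_fderiv ?_
  refine ContinuousLinearMap.ext fun X => ?_
  simp [parallelDeriv, add_assoc]

theorem parallelDeriv_injective (ha : 0 < a) (hq : q ∈ parallelParams) :
    Function.Injective (parallelDeriv a q) := by
  rw [injective_iff_map_eq_zero]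
  intro X hX
  have hs : 0 < √(1 - q.1.1 ^ 2) := sqrt_pos.2 (one_sub_sq_pos hq.1)
  have hg := gap_pos (arccos_mem_of_params hq.1)
  rw [parallelDeriv_apply] at hX
  have hlin (x y z : ℝ) : conormal a q.1 (x • ruling q.1 + y • helical a q.1 +
      z • unitNormal a q.1) = z * gap (arccos q.1.1) := by
    rw [← conormal_unitNormal ha hq.1]
    have e1 := conormal_ruling a q.1
    have e2 := conormal_helical ha q.1
    have : conormal a q.1 (x • ruling q.1 + y • helical a q.1 + z • unitNormal a q.1) =
        x * conormal a q.1 (ruling q.1) + y * conormal a q.1 (helical a q.1) +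
          z * conormal a q.1 (unitNormal a q.1) := by
      simp only [conormal, PiLp.add_apply, PiLp.smul_apply, smul_eq_mul]; ring
    rw [this, e1, e2]; ring
  have hz : X.2 = 0 := by
    have := hlin _ _ _ ▸ congrArg (conormal a q.1) hX
    have h0 : conormal a q.1 0 = 0 := by simp [conormal]
    rw [h0] at this
    exact (mul_eq_zero.1 this).resolve_right hg.ne'
  rw [hz, zero_smul, add_zero] at hX
  obtain ⟨h1, h2⟩ := ruling_add_helical_eq_zero ha hX
  have ht : 1 - q.2 ^ 2 ≠ 0 := by
    have := hq.2.1; have := hq.2.2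
    nlinarith
  have h3 : (1 - q.2 ^ 2) * X.1.1 = 0 := by
    field_simp at h1 h2
    linear_combination h1 - q.2 * h2
  have h4 := (mul_eq_zero.1 h3).resolve_left ht
  rw [h4] at h2
  refine Prod.ext (Prod.ext h4 ?_) hz
  simpa using h2

/-- The differential of `parallel` as an isomorphism. -/
noncomputable def parallelEquiv (ha : 0 < a) (hq : q ∈ parallelParams) :
    ((ℝ × ℝ) × ℝ) ≃L[ℝ] E3 :=
  (LinearMap.linearEquivOfInjective (parallelDeriv a q : (ℝ × ℝ) × ℝ →ₗ[ℝ] E3)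
    (parallelDeriv_injective ha hq) (by simp)).toContinuousLinearEquiv

theorem hasFDerivAt_parallelEquiv (ha : 0 < a) (hq : q ∈ parallelParams) :
    HasFDerivAt (parallel a) (parallelEquiv ha hq : (ℝ × ℝ) × ℝ →L[ℝ] E3) q :=
  (hasFDerivAt_parallel hq).congr_fderiv (ContinuousLinearMap.ext fun _ => rfl)

/-- The derivative of the unit normal in the parallel coordinates. -/
noncomputable def parallelShape (q : (ℝ × ℝ) × ℝ) : (ℝ × ℝ) × ℝ →ₗ[ℝ] (ℝ × ℝ) × ℝ where
  toFun X := (((√(1 - q.1.1 ^ 2) * X.1.2 - q.2 * X.1.1) / (1 - q.2 ^ 2),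
    (X.1.1 / √(1 - q.1.1 ^ 2) - q.2 * X.1.2) / (1 - q.2 ^ 2)), 0)
  map_add' X Y := by
    refine Prod.ext (Prod.ext ?_ ?_) ?_ <;> simp <;> ring
  map_smul' c X := by
    refine Prod.ext (Prod.ext ?_ ?_) ?_ <;> simp <;> ring

theorem parallelDeriv_parallelShape (hq : q ∈ parallelParams) (X : (ℝ × ℝ) × ℝ) :
    parallelDeriv a q (parallelShape q X) = unitNormalDeriv a q.1 X.1 := by
  have hs : 0 < √(1 - q.1.1 ^ 2) := sqrt_pos.2 (one_sub_sq_pos hq.1)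
  have ht : 1 - q.2 ^ 2 ≠ 0 := by
    have := hq.2.1; have := hq.2.2
    nlinarith
  rw [parallelDeriv_apply, unitNormalDeriv_apply]
  simp only [parallelShape, LinearMap.coe_mk, AddHom.coe_mk, zero_smul, add_zero]
  rw [add_comm]
  congr 2
  · field_simp; ring
  · field_simp; ring

theorem trace_parallelShape (q : (ℝ × ℝ) × ℝ) :
    LinearMap.trace ℝ ((ℝ × ℝ) × ℝ) (parallelShape q) = -2 * q.2 / (1 - q.2 ^ 2) := by
  rw [LinearMap.trace_eq_matrix_trace ℝ
    ((Module.Basis.finTwoProd ℝ).prod (Module.Basis.singleton Unit ℝ))]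
  simp [Matrix.trace, LinearMap.toMatrix_apply, parallelShape]
  ring

/-- The distance function of the parallel surfaces is isoparametric: its gradient is the unit
normal, and its Laplacian is minus the mean curvature `1 / (1 - t) - 1 / (1 + t)` of the parallel
surface at distance `t`. -/
theorem isLocalIsoparametric (ha : 0 < a) (hb : 0 < b)
    (hM : M.HasDual (helicoidDualDom a b) (helicoidDualMetric a b)) :
    M.IsLocalIsoparametric (helicoid a '' helicoidParams) := by
  rintro _ ⟨p, hp, rfl⟩
  have hq₀ : ((p, 0) : (ℝ × ℝ) × ℝ) ∈ parallelParams := ⟨hp, by norm_num, by norm_num⟩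
  have hn : (∞ : WithTop ℕ∞) ≠ 0 := by simp
  set e₀ := (contDiffAt_parallel (a := a) hq₀).toOpenPartialHomeomorph (parallel a)
    (hasFDerivAt_parallelEquiv ha hq₀) hn
  set e := e₀.restrOpen parallelParams isOpen_parallelParams
  have hesource : e.source ⊆ parallelParams := fun q hq => hq.2
  have hecoe : ∀ q, e q = parallel a q := fun q => rfl
  have hq₀e : ((p, 0) : (ℝ × ℝ) × ℝ) ∈ e.source :=
    ⟨(contDiffAt_parallel hq₀).mem_toOpenPartialHomeomorph_source _ _, hq₀⟩
  -- `G` recovers the parameters of a point of the helicoid, also far from `p`.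
  set G : E3 → ℝ × ℝ := fun y => (radius y, y 2 / a)
  have hGcont : Continuous G := continuous_radius.prodMk (by fun_prop)
  have hGhel : ∀ r ∈ helicoidParams, G (helicoid a r) = r := by
    intro r hr
    refine Prod.ext ?_ ?_
    · have : helicoid a r 0 ^ 2 + helicoid a r 1 ^ 2 = r.1 ^ 2 := by
        simp [helicoid]
        linear_combination r.1 ^ 2 * sin_sq_add_cos_sq r.2
      change √(helicoid a r 0 ^ 2 + helicoid a r 1 ^ 2) = r.1
      rw [this, sqrt_sq hr.1.1.le]
    · change a * r.2 / a = r.2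
      rw [mul_div_cancel_left₀ _ ha.ne']
  have hzero : ∀ r, parallel a (r, 0) = helicoid a r := fun r => by simp [parallel]
  set U : Set E3 := {y | y ∈ e.target ∧ (G y, (0 : ℝ)) ∈ e.source}
  set f : E3 → ℝ := fun y => (e.symm y).2
  have hUopen : IsOpen U :=
    e.open_target.inter (e.open_source.preimage (hGcont.prodMk continuous_const))
  have hpU : helicoid a p ∈ U := by
    refine ⟨?_, by rw [hGhel p hp]; exact hq₀e⟩
    rw [← hzero p]
    exact e.map_source hq₀e
  have hsymm : ∀ y ∈ e.target, e.symm y ∈ parallelParams := fun y hy =>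
    hesource (e.map_target hy)
  have hsmooth : ∀ y ∈ e.target, ContDiffAt ℝ ∞ e.symm y := fun y hy =>
    e.contDiffAt_symm hy (hasFDerivAt_parallelEquiv ha (hsymm y hy))
      (contDiffAt_parallel (hsymm y hy))
  have hderiv : ∀ y ∈ e.target, HasFDerivAt e.symm (fderiv ℝ e.symm y) y := fun y hy =>
    ((hsmooth y hy).differentiableAt hn).hasFDerivAt
  -- The differential of the inverse is inverse to the differential.
  have hinv : ∀ y ∈ e.target, ∀ X, fderiv ℝ e.symm y (parallelDeriv a (e.symm y) X) = X := by
    intro y hy X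
    have h1 := hderiv y hy
    have hey : y = parallel a (e.symm y) := (e.right_inv hy).symm
    rw [hey] at h1
    have h2 := h1.comp (e.symm y) (hasFDerivAt_parallel (hsymm y hy))
    have h3 : HasFDerivAt (e.symm ∘ parallel a) (ContinuousLinearMap.id ℝ _) (e.symm y) := by
      refine (hasFDerivAt_id _).congr_of_eventuallyEq ?_
      filter_upwards [e.open_source.mem_nhds (e.map_target hy)] with z hz using e.left_inv hz
    have h4 := congrArg (fun A : (ℝ × ℝ) × ℝ →L[ℝ] (ℝ × ℝ) × ℝ => A X) (h2.unique h3)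
    simp only [ContinuousLinearMap.comp_apply, ContinuousLinearMap.id_apply] at h4
    rwa [← hey] at h4
  have hfd : ∀ y ∈ e.target, ∀ v, fderiv ℝ f y v = (fderiv ℝ e.symm y v).2 := by
    intro y hy v
    have : HasFDerivAt f ((ContinuousLinearMap.snd ℝ (ℝ × ℝ) ℝ).comp (fderiv ℝ e.symm y)) y :=
      hasFDerivAt_snd.comp y (hderiv y hy)
    rw [this.fderiv]
    rfl
  have hdf : ∀ y ∈ e.target,
      fderiv ℝ f y = M.legendre (unitNormal a (e.symm y).1) := by
    intro y hy
    have hq := hsymm y hy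
    have hs : 0 < √(1 - (e.symm y).1.1 ^ 2) := sqrt_pos.2 (one_sub_sq_pos hq.1)
    have ht : 1 - (e.symm y).2 ^ 2 ≠ 0 := by
      have := hq.2.1; have := hq.2.2
      nlinarith
    have hg := gap_pos (arccos_mem_of_params hq.1)
    have hX : ∀ X, fderiv ℝ f y (parallelDeriv a (e.symm y) X) = X.2 := fun X => by
      rw [hfd y hy, hinv y hy]
    have e1 := hX ((1, 0), 0)
    have e2 := hX ((0, 1), 0)
    have e3 := hX ((0, 0), 1)
    simp only [parallelDeriv_apply, map_add, map_smul, smul_eq_mul] at e1 e2 e3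
    have hhel : fderiv ℝ f y (helical a (e.symm y).1) = 0 := by
      have : (1 - (e.symm y).2 ^ 2) * fderiv ℝ f y (helical a (e.symm y).1) = 0 := by
        have hss : √(1 - (e.symm y).1.1 ^ 2) * (1 / √(1 - (e.symm y).1.1 ^ 2)) = 1 :=
          mul_one_div_cancel hs.ne'
        linear_combination e2 - (e.symm y).2 * √(1 - (e.symm y).1.1 ^ 2) * e1 +
          (e.symm y).2 ^ 2 * fderiv ℝ f y (helical a (e.symm y).1) * hss
      exact (mul_eq_zero.1 this).resolve_left ht
    have hrul : fderiv ℝ f y (ruling (e.symm y).1) = 0 := by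
      rw [hhel] at e1
      linear_combination e1
    obtain ⟨k, hk⟩ := eq_smul_conormal ha hrul hhel
    have hnor : fderiv ℝ f y (unitNormal a (e.symm y).1) = 1 := by
      linear_combination e3
    have hk1 : k = 1 / gap (arccos (e.symm y).1.1) := by
      rw [eq_div_iff hg.ne', ← conormal_unitNormal ha hq.1, ← hk, hnor]
    ext v
    rw [hk, legendre_unitNormal ha hb hM hq.1, hk1]
    ring
  have hnd : ∀ y ∈ e.target, unitNormal a (e.symm y).1 ∈ M.dom := fun y hy =>
    (isUnitNormalOn_unitNormal ha hb hM).mem_dom _ (hsymm y hy).1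
  have hF1 : ∀ y ∈ e.target, M.F (unitNormal a (e.symm y).1) = 1 := fun y hy =>
    (isUnitNormalOn_unitNormal ha hb hM).unit _ (hsymm y hy).1
  have hne : ∀ y ∈ e.target, fderiv ℝ f y ≠ 0 := by
    intro y hy h0
    have := M.legendre_self (hnd y hy)
    rw [← hdf y hy, h0, hF1 y hy] at this
    simp at this
  have hgrad : ∀ y ∈ e.target, M.gradient f y = unitNormal a (e.symm y).1 := by
    intro y hy
    rw [ConicMinkowskiMetric.gradient, if_neg (hne y hy), hdf y hy,
      hM.legendreInv_legendre (hnd y hy)]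
  have hlap : ∀ y ∈ e.target, M.laplacian f y = -2 * f y / (1 - f y ^ 2) := by
    intro y hy
    have hq := hsymm y hy
    have h1 : HasFDerivAt (M.gradient f) ((unitNormalDeriv a (e.symm y).1).comp
        ((ContinuousLinearMap.fst ℝ (ℝ × ℝ) ℝ).comp (fderiv ℝ e.symm y))) y := by
      refine ((hasFDerivAt_unitNormal hq.1).comp y
        (hasFDerivAt_fst.comp y (hderiv y hy))).congr_of_eventuallyEq ?_
      filter_upwards [e.open_target.mem_nhds hy] with z hz using hgrad z hz
    rw [ConicMinkowskiMetric.laplacian, h1.fderiv]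
    set N : (ℝ × ℝ) × ℝ →ₗ[ℝ] E3 :=
      ↑((unitNormalDeriv a (e.symm y).1).comp (ContinuousLinearMap.fst ℝ (ℝ × ℝ) ℝ))
    set J : E3 →ₗ[ℝ] (ℝ × ℝ) × ℝ := ↑(fderiv ℝ e.symm y)
    change LinearMap.trace ℝ E3 (N ∘ₗ J) = _
    rw [LinearMap.trace_comp_comm' J N]
    have : J ∘ₗ N = parallelShape (e.symm y) := by
      refine LinearMap.ext fun X => ?_
      change fderiv ℝ e.symm y (unitNormalDeriv a (e.symm y).1 X.1) = _
      rw [← parallelDeriv_parallelShape hq, hinv y hy]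
    rw [this, trace_parallelShape]
  have hfsmooth : ∀ y ∈ e.target, ContDiffAt ℝ ∞ f y := fun y hy =>
    contDiffAt_snd.comp y (hsmooth y hy)
  refine ⟨U, f, 0, hpU, ?_, ?_, fun y hy => hne y hy.2.1⟩
  · refine ⟨hUopen, ?_, ?_, ?_, ?_, fun _ => 1, fun t => -2 * t / (1 - t ^ 2), contDiffOn_const,
      ?_, ?_⟩
    · by_contra! hcon
      refine hne _ hpU.1 ?_
      have : f =ᶠ[𝓝 (helicoid a p)] fun _ => f (helicoid a p) := by
        filter_upwards [hUopen.mem_nhds hpU] with y hy using hcon y hy _ hpU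
      rw [this.fderiv_eq]
      simp
    · exact fun y hy => ((hfsmooth y hy.1).of_le (by norm_cast)).contDiffWithinAt
    · intro y hy _
      rw [hdf y hy.1]
      exact mem_image_of_mem _ (hnd y hy.1)
    · exact fun y hy => (hfsmooth y hy.1.1).contDiffWithinAt
    · refine ContinuousOn.div (by fun_prop) (by fun_prop) ?_
      rintro _ ⟨y, hy, rfl⟩
      have h := (hsymm y hy.1.1).2
      have h1 : -1 < f y := h.1
      have h2 : f y < 1 := h.2
      nlinarith
    · intro y hy
      rw [hgrad y hy.1.1]
      exact ⟨hF1 y hy.1.1, hlap y hy.1.1⟩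
  · ext y
    constructor
    · rintro ⟨⟨r, hr, rfl⟩, hy⟩
      refine ⟨hy, ?_⟩
      have h1 := hy.2
      rw [hGhel r hr] at h1
      have h2 := e.left_inv h1
      rw [hecoe, hzero] at h2
      change (e.symm (helicoid a r)).2 = 0
      rw [h2]
    · rintro ⟨hy, h0⟩
      refine ⟨⟨(e.symm y).1, (hsymm y hy.1).1, ?_⟩, hy⟩
      have h1 := e.right_inv hy.1
      rw [hecoe] at h1
      have h2 : e.symm y = ((e.symm y).1, 0) := Prod.ext rfl h0
      rw [← hzero, ← h2, h1]

/-! ### Cylinders -/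

variable {a b : ℝ} {M : ConicMinkowskiMetric E3} {y z : E3}

theorem sin_sub_mul_cos_lt_gap {θ τ : ℝ} (hθ : θ ∈ Ioo 0 (π / 2)) (hτ : τ ∈ Ioo 0 (π / 2))
    (h : τ ≠ θ) : sin τ - τ * cos θ < gap θ := by
  have hθ' : θ ∈ Icc 0 π := ⟨hθ.1.le, by linarith [hθ.2, pi_pos]⟩
  have hτ' : τ ∈ Icc 0 π := ⟨hτ.1.le, by linarith [hτ.2, pi_pos]⟩
  unfold gap
  rcases lt_or_gt_of_ne h with hlt | hlt
  · have := StrictConcaveOn.lt_slope_of_hasDerivAt strictConcaveOn_sin_Icc hτ' hθ' hlt (hasDerivAt_sin θ)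
    rw [slope_def_field, lt_div_iff₀ (by linarith)] at this
    linarith
  · have := StrictConcaveOn.slope_lt_of_hasDerivAt strictConcaveOn_sin_Icc hθ' hτ' hlt (hasDerivAt_sin θ)
    rw [slope_def_field, div_lt_iff₀ (by linarith)] at this
    linarith

/-- The strict fundamental inequality on one nappe of the indicatrix. Between the two nappes it
fails. -/
theorem legendre_apply_le (ha : 0 < a) (hy : y ∈ cone a) (hz : z ∈ cone a)
    (hF : metric a y = metric a z) (hsign : SignType.sign (y 2) = SignType.sign (z 2)) :
    (helicoidMetric a ha).legendre y z ≤ metric a y ^ 2 ∧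
      ((helicoidMetric a ha).legendre y z = metric a y ^ 2 → y = z) := by
  have hθ := coneAngle_mem hy
  have hτ := coneAngle_mem hz
  have hg := gap_pos hθ
  have hF0 := metric_pos hy
  have hry := metric_mul_sin hy
  have hrz := metric_mul_sin hz
  have hhy := metric_mul_angle hy
  have hhz := metric_mul_angle hz
  have hy2 := radius_sq y
  have hz2 := radius_sq z
  have hry0 := hy.1
  have hrz0 := hz.1
  have hzabs : (SignType.sign (z 2) : ℝ) * z 2 / a = metric a y * coneAngle a z := by
    rw [sign_mul_self, hF, hhz]; rfl
  have hcs : y 0 * z 0 + y 1 * z 1 ≤ radius y * radius z := by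
    refine le_of_abs_le (abs_le_of_sq_le_sq ?_ (by positivity))
    rw [mul_pow, hy2, hz2]
    nlinarith [sq_nonneg (y 0 * z 1 - y 1 * z 0)]
  have hcs' : (y 0 * z 0 + y 1 * z 1) / radius y ≤ metric a y * sin (coneAngle a z) := by
    rw [hF, hrz, div_le_iff₀ hry0]; linarith
  have hgap : sin (coneAngle a z) - coneAngle a z * cos (coneAngle a y) ≤ gap (coneAngle a y) := by
    by_cases h : coneAngle a z = coneAngle a y
    · rw [h]; rfl
    · exact (sin_sub_mul_cos_lt_gap hθ hτ h).le
  have hbound : metric a y / gap (coneAngle a y) *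
      (metric a y * sin (coneAngle a z) - cos (coneAngle a y) * (metric a y * coneAngle a z)) =
      metric a y ^ 2 / gap (coneAngle a y) *
        (sin (coneAngle a z) - coneAngle a z * cos (coneAngle a y)) := by ring
  have hbound' : metric a y ^ 2 / gap (coneAngle a y) * gap (coneAngle a y) = metric a y ^ 2 :=
    div_mul_cancel₀ _ hg.ne'
  have hc1 : 0 < metric a y / gap (coneAngle a y) := by positivity
  have hc2 : 0 < metric a y ^ 2 / gap (coneAngle a y) := by positivity
  rw [legendre_apply ha hy, hsign, hzabs]
  have step1 := mul_le_mul_of_nonneg_left (sub_le_sub_right hcs'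
    (cos (coneAngle a y) * (metric a y * coneAngle a z))) hc1.le
  have step2 := mul_le_mul_of_nonneg_left hgap hc2.le
  refine ⟨by linarith, fun heq => ?_⟩
  have hangle : coneAngle a z = coneAngle a y := by
    by_contra h
    have := mul_lt_mul_of_pos_left (sin_sub_mul_cos_lt_gap hθ hτ h) hc2
    linarith
  have hrr : radius y = radius z := by rw [← hry, ← hrz, hF, hangle]
  have hdot : y 0 * z 0 + y 1 * z 1 = radius y ^ 2 := by
    have h1 : metric a y / gap (coneAngle a y) * ((y 0 * z 0 + y 1 * z 1) / radius y -
        cos (coneAngle a y) * (metric a y * coneAngle a z)) =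
        metric a y / gap (coneAngle a y) * (metric a y * sin (coneAngle a z) -
        cos (coneAngle a y) * (metric a y * coneAngle a z)) := by linarith
    have h2 := mul_left_cancel₀ hc1.ne' h1
    rw [hangle, hry] at h2
    have h3 : (y 0 * z 0 + y 1 * z 1) / radius y = radius y := by linarith
    rw [div_eq_iff hry0.ne'] at h3
    rw [h3, sq]
  have hsum : (y 0 - z 0) ^ 2 + (y 1 - z 1) ^ 2 = 0 := by
    rw [← hrr] at hz2
    linear_combination -hy2 - hz2 - 2 * hdot
  have h0 : (y 0 - z 0) ^ 2 = 0 := by linarith [sq_nonneg (y 0 - z 0), sq_nonneg (y 1 - z 1)]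
  have h1 : (y 1 - z 1) ^ 2 = 0 := by linarith [sq_nonneg (y 0 - z 0), sq_nonneg (y 1 - z 1)]
  have h2 : |y 2| = |z 2| := by
    have : height a y = height a z := by rw [← hhy, ← hhz, hF, hangle]
    simpa [height, ha.ne'] using this
  ext i
  fin_cases i
  · exact sub_eq_zero.1 (pow_eq_zero_iff two_ne_zero |>.1 h0)
  · exact sub_eq_zero.1 (pow_eq_zero_iff two_ne_zero |>.1 h1)
  · change y 2 = z 2
    rw [← sign_mul_abs (y 2), ← sign_mul_abs (z 2), h2, hsign]

theorem isOpen_helicoidDualDom (ha : 0 < a) (hb : 0 < b) : IsOpen (helicoidDualDom a b) := by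
  have : helicoidDualDom a b = {ξ | coord 2 ξ ≠ 0} ∩ {ξ | a * |coord 2 ξ| < coradius ξ} :=
    Set.ext fun ξ => mem_helicoidDualDom ha hb
  rw [this]
  have hcont : Continuous coradius := by unfold coradius; fun_prop
  exact (isOpen_ne_fun (coord 2).continuous continuous_const).inter
    (isOpen_lt (by fun_prop) hcont)

/-- The points of a cylinder are, as functionals on `V`, points of the sphere of radius `r` whose
Legendre transform lies in `V`. -/
theorem exists_of_mem_cylinder (ha : 0 < a) (hb : 0 < b)
    (hM : M.HasDual (helicoidDualDom a b) (helicoidDualMetric a b))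
    {V : Submodule ℝ (StrongDual ℝ E3)} {r : ℝ} {x : E3} (hx : x ∈ M.cylinder V r) :
    ∃ y ∈ cone a, metric a y = r ∧ (helicoidMetric a ha).legendre y ∈ V ∧ ∀ η ∈ V, η x = η y := by
  obtain ⟨ξ, hξV, ⟨y, hy, rfl⟩, hr, h⟩ := hx
  have hyc := (mem_dom_iff ha hb hM).1 hy
  have hself : M.HasDual M.dualDom M.dualMetric := ⟨hM.applicable, rfl, fun _ _ => rfl⟩
  have hmem : M.legendre y ∈ helicoidDualDom a b := hM.dualDom_eq ▸ mem_image_of_mem _ hy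
  have hdiff : DifferentiableAt ℝ M.dualMetric (M.legendre y) := by
    refine (differentiableAt_helicoidDualMetric ha hb hmem).congr_of_eventuallyEq ?_
    filter_upwards [(isOpen_helicoidDualDom ha hb).mem_nhds hmem] with ζ hζ
      using hM.dualMetric_eq hζ
  refine ⟨y, hyc, ?_, legendre_eq ha hb hM hyc ▸ hξV, fun η hη => ?_⟩
  · rw [← F_eq ha hb hM hyc, ← hr, ConicMinkowskiMetric.dualMetric, hM.legendreInv_legendre hy]
  · rw [h η hη, ← hself.apply_eq hy hdiff]

theorem exists_three_eq (f : Fin 5 → Bool) : ∃ i j k, i < j ∧ j < k ∧ f i = f j ∧ f j = f k := by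
  revert f; decide

/-- If a segment of a line of direction `w` lies in a cylinder over `V`, then `V` annihilates `w`:
of five points of the segment three belong to the same nappe, and its strict convexity forces two
of them to have the same image on `V`. -/
theorem apply_eq_zero_of_segment (ha : 0 < a) (hb : 0 < b)
    (hM : M.HasDual (helicoidDualDom a b) (helicoidDualMetric a b))
    {V : Submodule ℝ (StrongDual ℝ E3)} {r ε : ℝ} {x w : E3} (hε : 0 < ε)
    (h : ∀ t ∈ Ico 0 ε, x + t • w ∈ M.cylinder V r) {η : StrongDual ℝ E3} (hη : η ∈ V) :
    η w = 0 := by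
  have hmem (i : Fin 5) : ε * ((i : ℝ) / 5) ∈ Ico 0 ε := by
    have h1 : (i : ℝ) < 5 := by exact_mod_cast i.2
    refine ⟨by positivity, ?_⟩
    have : (i : ℝ) / 5 < 1 := by linarith
    exact mul_lt_of_lt_one_right hε this
  choose y hy hr hV hηy using fun i : Fin 5 =>
    exists_of_mem_cylinder ha hb hM (h _ (hmem i))
  obtain ⟨i, j, k, hij, hjk, e1, e2⟩ := exists_three_eq fun i => decide (0 < y i 2)
  simp only [decide_eq_decide] at e1 e2
  have hsign (m n : Fin 5) (e : 0 < y m 2 ↔ 0 < y n 2) :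
      SignType.sign (y m 2) = SignType.sign (y n 2) := by
    rcases lt_or_gt_of_ne (third_ne_zero (hy m)) with hm | hm
    · have hn : y n 2 < 0 := lt_of_le_of_ne (not_lt.1 fun hh => hm.not_gt (e.2 hh))
        (third_ne_zero (hy n))
      rw [sign_neg hm, sign_neg hn]
    · rw [sign_pos hm, sign_pos (e.1 hm)]
  obtain ⟨hi, hi'⟩ := legendre_apply_le ha (hy j) (hy i) ((hr j).trans (hr i).symm)
    (hsign j i e1.symm)
  obtain ⟨hk, -⟩ := legendre_apply_le ha (hy j) (hy k) ((hr j).trans (hr k).symm) (hsign j k e2)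
  have hj : (helicoidMetric a ha).legendre (y j) (y j) = metric a (y j) ^ 2 :=
    (helicoidMetric a ha).legendre_self (hy j)
  have hij' : (i : ℝ) < j := by exact_mod_cast hij
  have hjk' : (j : ℝ) < k := by exact_mod_cast hjk
  have hlin (m : Fin 5) (ζ : StrongDual ℝ E3) (hζ : ζ ∈ V) :
      ζ (y m) = ζ x + ε * ((m : ℝ) / 5) * ζ w := by
    rw [← hηy m ζ hζ, map_add, map_smul, smul_eq_mul]
  have hi1 := hlin i _ (hV j)
  have hj1 := hlin j _ (hV j)
  have hk1 := hlin k _ (hV j)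
  generalize (helicoidMetric a ha).legendre (y j) = ξ at *
  -- An affine function on the line with an interior maximum is constant.
  have hw : ξ w = 0 := by
    have h1 : 0 ≤ ε * (j - i) / 5 * ξ w := by
      have : ε * (j - i) / 5 * ξ w = ξ (y j) - ξ (y i) := by rw [hi1, hj1]; ring
      rw [this]; linarith
    have h2 : ε * (k - j) / 5 * ξ w ≤ 0 := by
      have : ε * (k - j) / 5 * ξ w = ξ (y k) - ξ (y j) := by rw [hk1, hj1]; ring
      rw [this]; linarith
    have p1 : 0 < ε * ((j : ℝ) - i) / 5 := by have := sub_pos.2 hij'; positivity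
    have p2 : 0 < ε * ((k : ℝ) - j) / 5 := by have := sub_pos.2 hjk'; positivity
    exact le_antisymm (nonpos_of_mul_nonpos_right h2 p2) (nonneg_of_mul_nonneg_right h1 p1)
  have hyij : y j = y i := hi' (by rw [hi1, hw, ← hj, hj1, hw]; ring)
  have e3 := hlin i η hη
  have e4 := hlin j η hη
  rw [hyij, e3] at e4
  have e5 : ε * ((j : ℝ) - i) / 5 * η w = 0 := by linear_combination -e4
  have p1 : 0 < ε * ((j : ℝ) - i) / 5 := by have := sub_pos.2 hij'; positivity
  exact (mul_eq_zero.1 e5).resolve_left p1.ne'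

/-- No piece of the helicoid lies in a cylinder: `V` would annihilate the directions of the rulings,
which span the horizontal plane, whereas covectors in `A*` do not vanish on that plane. -/
theorem not_subset_cylinder (ha : 0 < a) (hb : 0 < b)
    (hM : M.HasDual (helicoidDualDom a b) (helicoidDualMetric a b)) {U : Set E3} (hU : IsOpen U)
    (hne : (helicoid a '' helicoidParams ∩ U).Nonempty) (V : Submodule ℝ (StrongDual ℝ E3))
    (r : ℝ) (c : E3) :
    ¬ ∀ x ∈ helicoid a '' helicoidParams ∩ U, x - c ∈ M.cylinder V r := by
  intro hcyl
  obtain ⟨_, ⟨p, hp, rfl⟩, hpU⟩ := hne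
  have hopen : IsOpen (helicoidParams ∩ helicoid a ⁻¹' U) :=
    isOpen_helicoidParams.inter (hU.preimage (contDiff_helicoid a).continuous)
  obtain ⟨ε, hε, hball⟩ := Metric.isOpen_iff.1 hopen p ⟨hp, hpU⟩
  have hmem (s t : ℝ) (hs : |s| < ε) (ht : |t| < ε) :
      helicoid a (p.1 + s, p.2 + t) - c ∈ M.cylinder V r := by
    have : (p.1 + s, p.2 + t) ∈ Metric.ball p ε := by
      rw [Metric.mem_ball, Prod.dist_eq]
      simpa [Real.dist_eq] using ⟨hs, ht⟩
    exact hcyl _ ⟨mem_image_of_mem _ (hball this).1, (hball this).2⟩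
  have hruling (t : ℝ) (ht : |t| < ε) {η : StrongDual ℝ E3} (hη : η ∈ V) :
      η (ruling (p.1, p.2 + t)) = 0 := by
    refine apply_eq_zero_of_segment ha hb hM (r := r)
      (x := helicoid a (p.1, p.2 + t) - c) hε
      (fun s hs => ?_) hη
    have : helicoid a (p.1, p.2 + t) - c + s • ruling (p.1, p.2 + t) =
        helicoid a (p.1 + s, p.2 + t) - c := by
      ext i
      fin_cases i <;> simp [helicoid, ruling] <;> ring
    rw [this]
    exact hmem s t (by rw [abs_of_nonneg hs.1]; exact hs.2) ht
  obtain ⟨y, hy, -, hyV, -⟩ := exists_of_mem_cylinder ha hb hM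
    (hmem 0 0 (by simpa using hε) (by simpa using hε))
  set δ : ℝ := min (ε / 2) 1
  have hδ0 : 0 < δ := lt_min (by linarith) one_pos
  have hδε : δ < ε := (min_le_left _ _).trans_lt (by linarith)
  have hsin : 0 < sin δ :=
    sin_pos_of_pos_of_lt_pi hδ0 ((min_le_right _ _).trans_lt (by linarith [pi_gt_three]))
  have h0 := hruling 0 (by simpa using hε) hyV
  have h1 := hruling δ (by rwa [abs_of_pos hδ0]) hyV
  have hρ := coradius_legendre ha hy
  have hpos : 0 < metric a y / gap (coneAngle a y) :=
    div_pos (metric_pos hy) (gap_pos (coneAngle_mem hy))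
  rw [dual_apply] at h0 h1
  simp only [ruling, add_zero] at h0 h1
  simp [cos_add, sin_add] at h0 h1
  rw [coradius] at hρ
  generalize coord 0 ((helicoidMetric a ha).legendre y) = ξ₀ at *
  generalize coord 1 ((helicoidMetric a ha).legendre y) = ξ₁ at *
  have hsc := sin_sq_add_cos_sq p.2
  have h2 : -ξ₀ * sin p.2 + ξ₁ * cos p.2 = 0 := by
    have : sin δ * (-ξ₀ * sin p.2 + ξ₁ * cos p.2) = 0 := by
      linear_combination h1 - cos δ * h0
    exact (mul_eq_zero.1 this).resolve_left hsin.ne'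
  have hξ₀ : ξ₀ = 0 := by linear_combination cos p.2 * h0 - sin p.2 * h2 - ξ₀ * hsc
  have hξ₁ : ξ₁ = 0 := by linear_combination sin p.2 * h0 + cos p.2 * h2 - ξ₁ * hsc
  rw [hξ₀, hξ₁] at hρ
  simp at hρ
  linarith

end HelicoidMetric

theorem theorem1p2 (a b : ℝ) (ha : 0 < a) (hb : 0 < b) :
    (∃ M : ConicMinkowskiMetric (EuclideanSpace ℝ (Fin 3)),
      M.IsAlphaBeta (innerSL ℝ (betaStar b)) ∧
        M.HasDual (helicoidDualDom a b) (helicoidDualMetric a b)) ∧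
    ∀ M : ConicMinkowskiMetric (EuclideanSpace ℝ (Fin 3)),
      M.HasDual (helicoidDualDom a b) (helicoidDualMetric a b) →
        M.IsConicHypersurface (helicoid a) helicoidParams ∧
        M.IsLocalIsoparametric (helicoid a '' helicoidParams) ∧
        M.IsMinimal (helicoid a) helicoidParams ∧
        (∀ (W : Set (ℝ × ℝ)) (n : ℝ × ℝ → EuclideanSpace ℝ (Fin 3)),
          IsOpen W → W ⊆ helicoidParams → M.IsUnitNormalOn (helicoid a) n W →
            ∀ p ∈ W, ∀ k : ℝ, M.IsPrincipalCurvature (helicoid a) n p k ↔ k = 1 ∨ k = -1) ∧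
        (∀ (U : Set (EuclideanSpace ℝ (Fin 3))), IsOpen U →
          (helicoid a '' helicoidParams ∩ U).Nonempty →
            ∀ (V : Submodule ℝ (StrongDual ℝ (EuclideanSpace ℝ (Fin 3)))) (r : ℝ)
              (c : EuclideanSpace ℝ (Fin 3)),
              ¬ ∀ x ∈ helicoid a '' helicoidParams ∩ U, x - c ∈ M.cylinder V r) := by
  refine ⟨⟨HelicoidMetric.helicoidMetric a ha, HelicoidMetric.isAlphaBeta ha hb,
    HelicoidMetric.hasDual ha hb⟩, fun M hM => ?_⟩
  exact ⟨HelicoidMetric.isConicHypersurface ha hb hM,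
    HelicoidMetric.isLocalIsoparametric ha hb hM, HelicoidMetric.isMinimal ha hb hM,
    fun _ _ hW hWs hn _ hp k => HelicoidMetric.isPrincipalCurvature_iff ha hb hM hW hWs hn hp k,
    fun _ hU hne V r c => HelicoidMetric.not_subset_cylinder ha hb hM hU hne V r c⟩
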